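/- Let $k$ be a field, let $p_1,p_2,p_3\ge 2$ be integers and let $\lambda\in k\setminus\{0\}$. Let $\Lambda=\Lambda(p_1,p_2,p_3;\lambda)$ be the canonical algebra with three weights, that is, the path algebra of the quiver consisting of a source, a sink and, for $i=1,2,3$, an arm formed by $p_i$ consecutive arrows $x_i$ leading from the source to the sink through $p_i-1$ further vertices, modulo the relation $x_3^{p_3}=x_1^{p_1}-\lambda x_2^{p_2}$, where $x_i^{p_i}$ is the path from the source to the sink along the $i$-th arm. (Paths are composed like functions, and modules are finite-dimensional right modules, so the module over a path algebra is a family of spaces $M(v)=Me_v$, with $e_v$ the trivial path at the vertex $v$.) For a finite-dimensional $k$-algebra $B$ a $B$-module $E$ is called exceptional if $\operatorname{End}_B(E)=k$ and $\operatorname{Ext}^n_B(E,E)=0$ for all $n>0$. The one-point extension of $B$ by $E$ is $B[E]=\begin{pmatrix}B&0\\E&k\end{pmatrix}$, the one-point coextension is $\begin{pmatrix}k&0\\DE&B\end{pmatrix}$ with $DE=\operatorname{Hom}_k(E,k)$. A $k$-algebra $A$ is called accessible if there are finite-dimensional $k$-algebras $A_1=k,A_2,\dots,A_n=A$ such that each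 $A_{s+1}$ is isomorphic to a one-point extension or coextension of $A_s$ by an exceptional $A_s$-module. Then $\Lambda$ is accessible. Moreover, let $B$ be the path algebra of the star $[p_1,p_2,p_3]$, which consists of a center and three arms with $p_1-1$, $p_2-1$, $p_3-1$ further vertices, all arrows pointing away from the center. Then there is an exceptional $B$-module $M$ with $\dim_k M(v)=2$ for the center $v$ and $\dim_k M(v)=1$ for every other vertex $v$, such that $\Lambda$ is isomorphic, as a $k$-algebra, to the one-point extension $B[M]$. -/

import Mathlib

universe u

section PathAlgebra

/-- The oriented paths of a quiver (including the trivial path at each vertex), each one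
given together with its source and its target. -/
abbrev QuiverPath (V : Type) [Quiver.{0} V] : Type := Σ a b : V, Quiver.Path a b

/-- The path algebra of a quiver with finitely many vertices: the vector space with basis all
oriented paths. Paths are composed like functions: `p * q` means "first `q`, then `p`", and it
is zero unless `q` ends where `p` starts. -/
def PathAlgebra (k : Type u) [Field k] (V : Type) [Quiver.{0} V] : Type u :=
  QuiverPath V →₀ k

namespace PathAlgebra

variable (k : Type u) [Field k] (V : Type) [Quiver.{0} V]

noncomputable instance : AddCommGroup (PathAlgebra k V) :=
  inferInstanceAs (AddCommGroup (QuiverPath V →₀ k))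

noncomputable instance : Module k (PathAlgebra k V) :=
  inferInstanceAs (Module k (QuiverPath V →₀ k))

variable {V}

/-- The basis element of the path algebra given by a path. -/
noncomputable def ofPath {a b : V} (p : Quiver.Path a b) : PathAlgebra k V :=
  Finsupp.single (⟨a, b, p⟩ : QuiverPath V) (1 : k)

variable (V) in
/-- The paths form a basis of the path algebra. -/
noncomputable def basis : Module.Basis (QuiverPath V) k (PathAlgebra k V) :=
  Module.Basis.ofRepr (LinearEquiv.refl k (QuiverPath V →₀ k))

theorem basis_apply (p : QuiverPath V) : basis k V p = ofPath k p.2.2 := rfl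

variable {k} in
@[elab_as_elim]
theorem induction_on {motive : PathAlgebra k V → Prop} (x : PathAlgebra k V)
    (h0 : motive 0) (hadd : ∀ x y, motive x → motive y → motive (x + y))
    (hp : ∀ (c : k) (a b : V) (p : Quiver.Path a b), motive (c • ofPath k p)) : motive x := by
  refine Finsupp.induction_linear (motive := motive) x h0 hadd ?_
  rintro ⟨a, b, p⟩ c
  have e : (Finsupp.single (⟨a, b, p⟩ : QuiverPath V) c) =
      c • (Finsupp.single (⟨a, b, p⟩ : QuiverPath V) (1 : k)) := by simp
  rw [e]
  exact hp c a b p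

variable [DecidableEq V]

/-- The product `p * q` of two basis elements: `q` followed by `p`, or zero. -/
noncomputable def mulPath (p q : QuiverPath V) : PathAlgebra k V :=
  if h : p.1 = q.2.1 then ofPath k (q.2.2.comp (p.2.2.cast h rfl)) else 0

variable (V) in
/-- The bilinear extension of the product of paths. -/
noncomputable def mulHom : PathAlgebra k V →ₗ[k] PathAlgebra k V →ₗ[k] PathAlgebra k V :=
  (basis k V).constr k fun p => (basis k V).constr k fun q => mulPath k p q

noncomputable instance : Mul (PathAlgebra k V) := ⟨fun x y => mulHom k V x y⟩

variable {k}

theorem mul_def (x y : PathAlgebra k V) : x * y = mulHom k V x y := rfl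

theorem ofPath_mul_ofPath {a b c d : V} (p : Quiver.Path a b) (q : Quiver.Path c d) :
    ofPath k p * ofPath k q = mulPath k ⟨a, b, p⟩ ⟨c, d, q⟩ := by
  rw [mul_def, mulHom, ← basis_apply k ⟨a, b, p⟩, ← basis_apply k ⟨c, d, q⟩,
    Module.Basis.constr_basis, Module.Basis.constr_basis]

theorem ofPath_mul_ofPath_comp {a b c : V} (p : Quiver.Path b c) (q : Quiver.Path a b) :
    ofPath k p * ofPath k q = ofPath k (q.comp p) := by
  rw [ofPath_mul_ofPath]
  simp [mulPath]

theorem ofPath_mul_ofPath_of_ne {a b c d : V} (p : Quiver.Path a b) (q : Quiver.Path c d)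
    (h : a ≠ d) : ofPath k p * ofPath k q = 0 := by
  rw [ofPath_mul_ofPath]
  simp [mulPath, h]

theorem add_mul_aux (x y z : PathAlgebra k V) : (x + y) * z = x * z + y * z := by
  simp [mul_def]

theorem mul_add_aux (x y z : PathAlgebra k V) : x * (y + z) = x * y + x * z := by
  simp [mul_def]

theorem zero_mul_aux (x : PathAlgebra k V) : 0 * x = 0 := by
  simp [mul_def]

theorem mul_zero_aux (x : PathAlgebra k V) : x * 0 = 0 := by
  simp [mul_def]

theorem smul_mul_aux (c : k) (x y : PathAlgebra k V) : (c • x) * y = c • (x * y) := by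
  simp [mul_def]

theorem mul_smul_aux (c : k) (x y : PathAlgebra k V) : x * (c • y) = c • (x * y) := by
  simp [mul_def]

theorem mul_assoc_aux (x y z : PathAlgebra k V) : x * y * z = x * (y * z) := by
  refine induction_on x ?_ ?_ ?_
  · simp only [zero_mul_aux]
  · intro x₁ x₂ h₁ h₂
    simp only [add_mul_aux, h₁, h₂]
  intro c a b p
  refine induction_on y ?_ ?_ ?_
  · simp only [zero_mul_aux, mul_zero_aux]
  · intro x₁ x₂ h₁ h₂
    simp only [add_mul_aux, mul_add_aux, h₁, h₂]
  intro c' a' b' p'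
  refine induction_on z ?_ ?_ ?_
  · simp only [mul_zero_aux]
  · intro x₁ x₂ h₁ h₂
    simp only [mul_add_aux, h₁, h₂]
  intro c'' a'' b'' p''
  simp only [smul_mul_aux, mul_smul_aux]
  congr 3
  by_cases h : a = b'
  · subst h
    by_cases h' : a' = b''
    · subst h'
      simp only [ofPath_mul_ofPath_comp, Quiver.Path.comp_assoc]
    · rw [ofPath_mul_ofPath_comp, ofPath_mul_ofPath_of_ne p' p'' h', mul_zero_aux,
        ofPath_mul_ofPath_of_ne _ _ h']
  · rw [ofPath_mul_ofPath_of_ne _ _ h, zero_mul_aux]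
    by_cases h' : a' = b''
    · subst h'
      rw [ofPath_mul_ofPath_comp, ofPath_mul_ofPath_of_ne _ _ h]
    · rw [ofPath_mul_ofPath_of_ne _ _ h', mul_zero_aux]

variable (k) in
/-- The idempotent of the path algebra given by the trivial path at the vertex `v`. -/
noncomputable def idem (v : V) : PathAlgebra k V := ofPath k (Quiver.Path.nil : Quiver.Path v v)

variable (k) in
/-- The element of the path algebra given by an arrow. -/
noncomputable def ofArrow {a b : V} (x : a ⟶ b) : PathAlgebra k V := ofPath k x.toPath

variable [Fintype V]

noncomputable instance : One (PathAlgebra k V) := ⟨∑ v : V, idem k v⟩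

theorem one_def : (1 : PathAlgebra k V) = ∑ v : V, idem k v := rfl

theorem one_mul_aux (x : PathAlgebra k V) : 1 * x = x := by
  refine induction_on x ?_ ?_ ?_
  · rw [mul_zero_aux]
  · intro x₁ x₂ h₁ h₂
    rw [mul_add_aux, h₁, h₂]
  intro c a b p
  rw [mul_smul_aux, one_def, mul_def, map_sum, LinearMap.sum_apply, Finset.sum_eq_single b]
  · rw [← mul_def]
    unfold idem
    rw [ofPath_mul_ofPath_comp, Quiver.Path.comp_nil]
  · intro v _ hv
    rw [← mul_def]
    exact ofPath_mul_ofPath_of_ne _ _ hv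
  · simp

theorem mul_one_aux (x : PathAlgebra k V) : x * 1 = x := by
  refine induction_on x ?_ ?_ ?_
  · rw [zero_mul_aux]
  · intro x₁ x₂ h₁ h₂
    rw [add_mul_aux, h₁, h₂]
  intro c a b p
  rw [smul_mul_aux, one_def, mul_def, map_sum, Finset.sum_eq_single a]
  · rw [← mul_def]
    unfold idem
    rw [ofPath_mul_ofPath_comp, Quiver.Path.nil_comp]
  · intro v _ hv
    rw [← mul_def]
    exact ofPath_mul_ofPath_of_ne _ _ hv.symm
  · simp

noncomputable instance : Ring (PathAlgebra k V) :=
  { (inferInstance : AddCommGroup (PathAlgebra k V)) with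
    mul := (· * ·)
    one := 1
    left_distrib := mul_add_aux
    right_distrib := add_mul_aux
    zero_mul := zero_mul_aux
    mul_zero := mul_zero_aux
    mul_assoc := mul_assoc_aux
    one_mul := one_mul_aux
    mul_one := mul_one_aux }

noncomputable instance : Algebra k (PathAlgebra k V) :=
  Algebra.ofModule smul_mul_aux mul_smul_aux

variable (k) (M : Type u) [AddCommGroup M] [Module k M] [Module (PathAlgebra k V)ᵐᵒᵖ M]
  [IsScalarTower k (PathAlgebra k V)ᵐᵒᵖ M]

/-- The dimension vector of a right module `M` over a path algebra: its entry at the vertex `v`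
is the dimension of `M(v) = M e_v`, where `e_v` is the trivial path at `v`. -/
noncomputable def dimVector (v : V) : ℕ :=
  Module.finrank k (LinearMap.range (Algebra.lsmul k k M (MulOpposite.op (idem k v))))

end PathAlgebra

end PathAlgebra

section Accessible

variable (k : Type u) [Field k] (A : Type u) [Ring A] [Algebra k A]
  (M : Type u) [AddCommGroup M] [Module k M] [Module Aᵐᵒᵖ M] [IsScalarTower k Aᵐᵒᵖ M]

/-- A finite-dimensional right `A`-module `M` is exceptional if `End_A(M) = k` and
`Ext^n_A(M, M) = 0` for all `n > 0`. -/
structure IsExceptionalModule : Prop where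
  finite : Module.Finite k M
  end_eq : Function.Bijective (algebraMap k (Module.End Aᵐᵒᵖ M))
  ext_eq_zero : ∀ n : ℕ, 0 < n → Subsingleton
    (CategoryTheory.Abelian.Ext (ModuleCat.of Aᵐᵒᵖ M) (ModuleCat.of Aᵐᵒᵖ M) n)

/-- The one-point extension `A[M]` of `A` by the right `A`-module `M`: the algebra of the
matrices `[[a, 0], [m, c]]` with `a ∈ A`, `m ∈ M`, `c ∈ k`. Such a matrix is the
triple `(a, m, c)`. -/
@[nolint unusedArguments]
def OnePointExtension (k : Type u) [Field k] (A : Type u) [Ring A] [Algebra k A]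
    (M : Type u) [AddCommGroup M] [Module k M] [Module Aᵐᵒᵖ M] [IsScalarTower k Aᵐᵒᵖ M] :
    Type u := A × M × k

namespace OnePointExtension

instance : AddCommGroup (OnePointExtension k A M) :=
  inferInstanceAs (AddCommGroup (A × M × k))

instance : Module k (OnePointExtension k A M) :=
  inferInstanceAs (Module k (A × M × k))

/-- Multiplication of matrices:
`[[a, 0], [m, c]] [[a', 0], [m', c']] = [[a a', 0], [m a' + c m', c c']]`. -/
instance : Mul (OnePointExtension k A M) :=
  ⟨fun x y => ((x.1 * y.1, MulOpposite.op y.1 • x.2.1 + x.2.2 • y.2.1, x.2.2 * y.2.2) :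
    A × M × k)⟩

instance : One (OnePointExtension k A M) := ⟨((1, 0, 1) : A × M × k)⟩

theorem mul_def (x y : OnePointExtension k A M) :
    x * y = ((x.1 * y.1, MulOpposite.op y.1 • x.2.1 + x.2.2 • y.2.1, x.2.2 * y.2.2) :
      A × M × k) := rfl

instance : Ring (OnePointExtension k A M) :=
  { (inferInstance : AddCommGroup (OnePointExtension k A M)) with
    mul := (· * ·)
    one := 1
    left_distrib := by
      rintro ⟨a, m, c⟩ ⟨a', m', c'⟩ ⟨a'', m'', c''⟩
      refine Prod.ext (mul_add a a' a'') (Prod.ext ?_ (mul_add c c' c''))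
      change MulOpposite.op (a' + a'') • m + c • (m' + m'') =
        (MulOpposite.op a' • m + c • m') + (MulOpposite.op a'' • m + c • m'')
      rw [MulOpposite.op_add, add_smul, smul_add]
      abel
    right_distrib := by
      rintro ⟨a, m, c⟩ ⟨a', m', c'⟩ ⟨a'', m'', c''⟩
      refine Prod.ext (add_mul a a' a'') (Prod.ext ?_ (add_mul c c' c''))
      change MulOpposite.op a'' • (m + m') + (c + c') • m'' =
        (MulOpposite.op a'' • m + c • m'') + (MulOpposite.op a'' • m' + c' • m'')
      rw [add_smul, smul_add]
      abel
    zero_mul := by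
      rintro ⟨a, m, c⟩
      refine Prod.ext (zero_mul a) (Prod.ext ?_ (zero_mul c))
      change MulOpposite.op a • (0 : M) + (0 : k) • m = 0
      simp
    mul_zero := by
      rintro ⟨a, m, c⟩
      refine Prod.ext (mul_zero a) (Prod.ext ?_ (mul_zero c))
      change MulOpposite.op (0 : A) • m + c • (0 : M) = 0
      simp
    mul_assoc := by
      rintro ⟨a, m, c⟩ ⟨a', m', c'⟩ ⟨a'', m'', c''⟩
      refine Prod.ext (mul_assoc a a' a'') (Prod.ext ?_ (mul_assoc c c' c''))
      change MulOpposite.op a'' • (MulOpposite.op a' • m + c • m') + (c * c') • m'' =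
        MulOpposite.op (a' * a'') • m + c • (MulOpposite.op a'' • m' + c' • m'')
      rw [smul_add, smul_add, MulOpposite.op_mul, mul_smul, mul_smul,
        smul_comm c (MulOpposite.op a'') m', add_assoc]
    one_mul := by
      rintro ⟨a, m, c⟩
      refine Prod.ext (one_mul a) (Prod.ext ?_ (one_mul c))
      change MulOpposite.op a • (0 : M) + (1 : k) • m = m
      simp
    mul_one := by
      rintro ⟨a, m, c⟩
      refine Prod.ext (mul_one a) (Prod.ext ?_ (mul_one c))
      change MulOpposite.op (1 : A) • m + c • (0 : M) = m
      simp }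

instance : Algebra k (OnePointExtension k A M) :=
  Algebra.ofModule
    (by
      rintro r ⟨a, m, c⟩ ⟨a', m', c'⟩
      refine Prod.ext (smul_mul_assoc r a a') (Prod.ext ?_ (smul_mul_assoc r c c'))
      change MulOpposite.op a' • (r • m) + (r • c) • m' =
        r • (MulOpposite.op a' • m + c • m')
      rw [smul_add, smul_comm r, smul_assoc])
    (by
      rintro r ⟨a, m, c⟩ ⟨a', m', c'⟩
      refine Prod.ext (mul_smul_comm r a a') (Prod.ext ?_ (mul_smul_comm r c c'))
      change MulOpposite.op (r • a') • m + c • (r • m') =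
        r • (MulOpposite.op a' • m + c • m')
      rw [smul_add, smul_comm r c, MulOpposite.op_smul, smul_assoc])

end OnePointExtension

/-- The one-point coextension `[M]A` of `A` by the right `A`-module `M`: the algebra of the
matrices `[[c, 0], [f, a]]` with `c ∈ k`, `f ∈ DM = Hom_k(M, k)`, `a ∈ A`, where `DM` is a left
`A`-module by `(a f)(m) = f(m a)`. Such a matrix is the triple `(c, f, a)`. -/
@[nolint unusedArguments]
def OnePointCoextension (k : Type u) [Field k] (A : Type u) [Ring A] [Algebra k A]
    (M : Type u) [AddCommGroup M] [Module k M] [Module Aᵐᵒᵖ M] [IsScalarTower k Aᵐᵒᵖ M] :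
    Type u := k × Module.Dual k M × A

namespace OnePointCoextension

instance : AddCommGroup (OnePointCoextension k A M) :=
  inferInstanceAs (AddCommGroup (k × Module.Dual k M × A))

instance : Module k (OnePointCoextension k A M) :=
  inferInstanceAs (Module k (k × Module.Dual k M × A))

variable {k A M} in
/-- The left action of `A` on the dual of a right `A`-module: `(a f)(m) = f(m a)`. -/
def dualAct (a : A) (f : Module.Dual k M) : Module.Dual k M :=
  f ∘ₗ Algebra.lsmul k k M (MulOpposite.op a)

/-- Multiplication of matrices:
`[[c, 0], [f, a]] [[c', 0], [f', a']] = [[c c', 0], [f c' + a f', a a']]`. -/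
instance : Mul (OnePointCoextension k A M) :=
  ⟨fun x y => ((x.1 * y.1, y.1 • x.2.1 + dualAct x.2.2 y.2.1, x.2.2 * y.2.2) :
    k × Module.Dual k M × A)⟩

instance : One (OnePointCoextension k A M) := ⟨((1, 0, 1) : k × Module.Dual k M × A)⟩

theorem mul_def (x y : OnePointCoextension k A M) :
    x * y = ((x.1 * y.1, y.1 • x.2.1 + dualAct x.2.2 y.2.1, x.2.2 * y.2.2) :
      k × Module.Dual k M × A) := rfl

instance : Ring (OnePointCoextension k A M) :=
  { (inferInstance : AddCommGroup (OnePointCoextension k A M)) with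
    mul := (· * ·)
    one := 1
    left_distrib := by
      rintro ⟨c, f, a⟩ ⟨c', f', a'⟩ ⟨c'', f'', a''⟩
      refine Prod.ext (mul_add c c' c'') (Prod.ext ?_ (mul_add a a' a''))
      change (c' + c'') • f + dualAct a (f' + f'') =
        (c' • f + dualAct a f') + (c'' • f + dualAct a f'')
      ext m
      simp [dualAct]
      ring
    right_distrib := by
      rintro ⟨c, f, a⟩ ⟨c', f', a'⟩ ⟨c'', f'', a''⟩
      refine Prod.ext (add_mul c c' c'') (Prod.ext ?_ (add_mul a a' a''))
      change c'' • (f + f') + dualAct (a + a') f'' =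
        (c'' • f + dualAct a f'') + (c'' • f' + dualAct a' f'')
      ext m
      simp [dualAct]
      ring
    zero_mul := by
      rintro ⟨c, f, a⟩
      refine Prod.ext (zero_mul c) (Prod.ext ?_ (zero_mul a))
      change c • (0 : Module.Dual k M) + dualAct (0 : A) f = 0
      ext m
      simp [dualAct]
    mul_zero := by
      rintro ⟨c, f, a⟩
      refine Prod.ext (mul_zero c) (Prod.ext ?_ (mul_zero a))
      change (0 : k) • f + dualAct a (0 : Module.Dual k M) = 0
      ext m
      simp [dualAct]
    mul_assoc := by
      rintro ⟨c, f, a⟩ ⟨c', f', a'⟩ ⟨c'', f'', a''⟩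
      refine Prod.ext (mul_assoc c c' c'') (Prod.ext ?_ (mul_assoc a a' a''))
      change c'' • (c' • f + dualAct a f') + dualAct (a * a') f'' =
        (c' * c'') • f + dualAct a (c'' • f' + dualAct a' f'')
      ext m
      simp [dualAct, mul_smul]
      ring
    one_mul := by
      rintro ⟨c, f, a⟩
      refine Prod.ext (one_mul c) (Prod.ext ?_ (one_mul a))
      change c • (0 : Module.Dual k M) + dualAct (1 : A) f = f
      ext m
      simp [dualAct]
    mul_one := by
      rintro ⟨c, f, a⟩
      refine Prod.ext (mul_one c) (Prod.ext ?_ (mul_one a))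
      change (1 : k) • f + dualAct a (0 : Module.Dual k M) = f
      ext m
      simp [dualAct] }

instance : Algebra k (OnePointCoextension k A M) :=
  Algebra.ofModule
    (by
      rintro r ⟨c, f, a⟩ ⟨c', f', a'⟩
      refine Prod.ext (smul_mul_assoc r c c') (Prod.ext ?_ (smul_mul_assoc r a a'))
      change c' • (r • f) + dualAct (r • a) f' = r • (c' • f + dualAct a f')
      ext m
      simp [dualAct]
      ring)
    (by
      rintro r ⟨c, f, a⟩ ⟨c', f', a'⟩
      refine Prod.ext (mul_smul_comm r c c') (Prod.ext ?_ (mul_smul_comm r a a'))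
      change (r • c') • f + dualAct a (r • f') = r • (c' • f + dualAct a f')
      ext m
      simp [dualAct]
      ring)

end OnePointCoextension

/-- A `k`-algebra is accessible if it is obtained, up to isomorphism, from the algebra `k` by
finitely many steps, each of which is a one-point extension or a one-point coextension
with an exceptional module. -/
inductive IsAccessible (k : Type u) [Field k] :
    (A : Type u) → [Ring A] → [Algebra k A] → Prop
  | base {A : Type u} [Ring A] [Algebra k A] (e : A ≃ₐ[k] k) : IsAccessible k A
  | extension {A B : Type u} [Ring A] [Algebra k A] [Ring B] [Algebra k B]
      (hB : IsAccessible k B)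
      (E : Type u) [AddCommGroup E] [Module k E] [Module Bᵐᵒᵖ E] [IsScalarTower k Bᵐᵒᵖ E]
      (hE : IsExceptionalModule k B E)
      (e : A ≃ₐ[k] OnePointExtension k B E) : IsAccessible k A
  | coextension {A B : Type u} [Ring A] [Algebra k A] [Ring B] [Algebra k B]
      (hB : IsAccessible k B)
      (E : Type u) [AddCommGroup E] [Module k E] [Module Bᵐᵒᵖ E] [IsScalarTower k Bᵐᵒᵖ E]
      (hE : IsExceptionalModule k B E)
      (e : A ≃ₐ[k] OnePointCoextension k B E) : IsAccessible k A

end Accessible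

section Star

/-- The vertices of the star `[p_1, …, p_t]`: a center and `t` arms, the `i`-th of which has
`p_i - 1` vertices. -/
inductive StarVertex {t : ℕ} (p : Fin t → ℕ) : Type
  | center : StarVertex p
  | arm (i : Fin t) (j : Fin (p i - 1)) : StarVertex p
  deriving DecidableEq, Fintype

namespace StarVertex

variable {t : ℕ} (p : Fin t → ℕ)

/-- The source of the `j`-th arrow (counted from `0`) of the `i`-th arm of the star. -/
def src (i : Fin t) (j : Fin (p i - 1)) : StarVertex p :=
  if j.val = 0 then center else arm i ⟨j.val - 1, by omega⟩

/-- The star with its standard orientation, all arrows pointing away from the center: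
the `i`-th arm is `center → (i,0) → (i,1) → ⋯ → (i,p_i - 2)`. -/
instance : Quiver.{0} (StarVertex p) where
  Hom a b := { x : Σ i : Fin t, Fin (p i - 1) // src p x.1 x.2 = a ∧ arm x.1 x.2 = b }

end StarVertex

end Star

section Canonical

/-- The vertices of the quiver of a canonical algebra of weight type `(p_1, …, p_t)`: a source,
a sink and `t` arms, the `i`-th of which has `p_i - 1` vertices. -/
inductive CanonicalVertex {t : ℕ} (p : Fin t → ℕ) : Type
  | source : CanonicalVertex p
  | arm (i : Fin t) (j : Fin (p i - 1)) : CanonicalVertex p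
  | sink : CanonicalVertex p
  deriving DecidableEq, Fintype

namespace CanonicalVertex

variable {t : ℕ} (p : Fin t → ℕ)

/-- The source of the `j`-th arrow (counted from `0`) of the `i`-th arm. -/
def src (i : Fin t) (j : Fin (p i)) : CanonicalVertex p :=
  if h : j.val = 0 then source else arm i ⟨j.val - 1, by omega⟩

/-- The target of the `j`-th arrow (counted from `0`) of the `i`-th arm. -/
def tgt (i : Fin t) (j : Fin (p i)) : CanonicalVertex p :=
  if h : j.val < p i - 1 then arm i ⟨j.val, h⟩ else sink

/-- The quiver of a canonical algebra: the `i`-th arm consists of `p_i` arrows,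
`source → (i,0) → (i,1) → ⋯ → (i,p_i - 2) → sink`. -/
instance : Quiver.{0} (CanonicalVertex p) where
  Hom a b := { x : Σ i : Fin t, Fin (p i) // src p x.1 x.2 = a ∧ tgt p x.1 x.2 = b }

/-- The `j`-th arrow (counted from `0`) of the `i`-th arm. -/
def arrow (i : Fin t) (j : Fin (p i)) : src p i j ⟶ tgt p i j :=
  ⟨⟨i, j⟩, rfl, rfl⟩

end CanonicalVertex

namespace CanonicalAlgebra

/-- The path `x_i^{p_i}` from the source to the sink along the `i`-th arm, as an element of the
path algebra: the product of the arrows of this arm, the last arrow standing leftmost. -/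
noncomputable def armPath (k : Type u) [Field k] {t : ℕ} (p : Fin t → ℕ) (i : Fin t) :
    PathAlgebra k (CanonicalVertex p) :=
  (List.ofFn fun j : Fin (p i) =>
    PathAlgebra.ofArrow k (CanonicalVertex.arrow p i j)).reverse.prod

/-- The relations `x_i^{p_i} = x_1^{p_1} - λ_i x_2^{p_2}`, `i = 3, …, t`. The number of weights
is `s + 2`; arms are indexed from `0`, and `lam j` is the parameter of the arm `j + 2`. -/
inductive Rel (k : Type u) [Field k] {s : ℕ} (p : Fin (s + 2) → ℕ) (lam : Fin s → k) :
    PathAlgebra k (CanonicalVertex p) → PathAlgebra k (CanonicalVertex p) → Prop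
  | mk (j : Fin s) : Rel k p lam (armPath k p ⟨j.val + 2, Nat.add_lt_add_right j.isLt 2⟩)
      (armPath k p 0 - lam j • armPath k p 1)

end CanonicalAlgebra

/-- The canonical algebra `Λ(p, λ)` with `s + 2` weights `p` and parameters `λ_3, …, λ_{s+2}`:
the path algebra of its quiver modulo the two-sided ideal generated by the relations. It is
considered for weights `p_i ≥ 2` and pairwise distinct nonzero parameters only. -/
abbrev CanonicalAlgebra (k : Type u) [Field k] {s : ℕ} (p : Fin (s + 2) → ℕ) (lam : Fin s → k) :
    Type u :=
  RingQuot (CanonicalAlgebra.Rel k p lam)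

end Canonical

-- Remove the sink from the quiver of `Λ`. What is left is the star with the source as its center,
-- so `Λ` is a triangular matrix algebra `B[M]`, where `M` consists of the classes of nontrivial
-- paths ending at the sink. At a vertex of an arm, `M` is the line spanned by the rest of that arm.
-- At the center the three arm paths satisfy one relation, so `M` is a plane there, in which they
-- are the vectors `(1, 0)`, `(0, 1)` and `(1, -λ)` of `planeVector`. Right multiplication by an
-- arrow lengthens a path at its beginning, so the structure maps of `M` run along the arms towards
-- the center. This module is `StarRep k p (planeVector (lam 0))`, and
-- `CanonicalAlgebra.equivOnePointExtension` is the resulting isomorphism, built from two mutually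
-- inverse homomorphisms given on generators.
--
-- `M` is exceptional because `λ ≠ 0`. The three vectors are then pairwise independent, so a linear
-- endomorphism of the plane that preserves their lines is a scalar (`StarRep.end_planeVector`). For
-- the extensions, the same module with `k^3` and its standard basis at the center is projective
-- (`StarRep.projective_standard`). It maps onto `M`, and the kernel is the one-dimensional
-- projective `e_c B` of the center `c`. Every homomorphism from this kernel to `M` extends to the
-- projective cover, hence all higher self-extensions vanish
-- (`ModuleCat.ext_subsingleton_of_resolution`).
--
-- `B` is accessible because a leaf of a rooted tree can be split off: if `u` is the parent of the
-- leaf, the path algebra is the one-point extension of the smaller path algebra by `e_u B'`. This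
-- module is projective with endomorphism ring `e_u B' e_u = k`, hence exceptional
-- (`PathAlgebra.isAccessible_of_tree`). The step from `B` to `B[M]` is the last one.

universe v

/-! ### Universal property of the path algebra -/

namespace PathAlgebra

variable {k : Type u} [Field k] {V : Type} [Quiver.{0} V] [DecidableEq V]

/-- Images of the trivial paths and of the arrows of a quiver in an algebra, subject to the
relations that hold in the path algebra. -/
structure LiftData (V : Type) [Quiver.{0} V] [DecidableEq V] (A : Type v) [Ring A] where
  e : V → A
  x : ∀ {a b : V}, (a ⟶ b) → A
  e_mul_e : ∀ a b, e a * e b = if a = b then e a else 0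
  e_mul_x : ∀ {a b : V} (q : a ⟶ b), e b * x q = x q
  x_mul_e : ∀ {a b : V} (q : a ⟶ b), x q * e a = x q

namespace LiftData

variable {A : Type v} [Ring A] [Algebra k A] (D : LiftData V A)

/-- The value of a path: the product of the values of its arrows. -/
def val {a : V} : ∀ {b : V}, Quiver.Path a b → A
  | _, .nil => D.e a
  | _, .cons p q => D.x q * val p

theorem e_mul_val {a b : V} (p : Quiver.Path a b) : D.e b * D.val p = D.val p := by
  cases p with
  | nil => simp [val, D.e_mul_e]
  | cons p q => rw [val, ← mul_assoc, D.e_mul_x]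

theorem val_mul_e {a b : V} (p : Quiver.Path a b) : D.val p * D.e a = D.val p := by
  induction p with
  | nil => simp [val, D.e_mul_e]
  | cons p q ih => rw [val, mul_assoc, ih]

theorem val_comp {a b c : V} (p : Quiver.Path a b) (q : Quiver.Path b c) :
    D.val (p.comp q) = D.val q * D.val p := by
  induction q with
  | nil => simp [val, D.e_mul_val]
  | cons q x ih => rw [Quiver.Path.comp_cons, val, val, ih, mul_assoc]

theorem val_mul_val_of_ne {a b c d : V} (p : Quiver.Path a b) (q : Quiver.Path c d) (h : a ≠ d) :
    D.val p * D.val q = 0 := by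
  rw [← D.val_mul_e p, ← D.e_mul_val q, mul_assoc, ← mul_assoc (D.e a), D.e_mul_e, if_neg h]
  simp

variable (k) in
/-- The linear map from the path algebra that extends the values of the paths. -/
noncomputable def liftLinear : PathAlgebra k V →ₗ[k] A :=
  (basis k V).constr k fun p => D.val p.2.2

theorem liftLinear_ofPath {a b : V} (p : Quiver.Path a b) :
    D.liftLinear k (ofPath k p) = D.val p := by
  rw [liftLinear, ← basis_apply k ⟨a, b, p⟩, Module.Basis.constr_basis]

theorem liftLinear_mul (x y : PathAlgebra k V) :
    D.liftLinear k (x * y) = D.liftLinear k x * D.liftLinear k y := by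
  refine induction_on x ?_ ?_ ?_
  · simp only [zero_mul_aux, map_zero, zero_mul]
  · intro x₁ x₂ h₁ h₂
    simp only [add_mul_aux, map_add, h₁, h₂, add_mul]
  intro c a b p
  refine induction_on y ?_ ?_ ?_
  · simp only [mul_zero_aux, map_zero, mul_zero]
  · intro x₁ x₂ h₁ h₂
    simp only [mul_add_aux, map_add, h₁, h₂, mul_add]
  intro c' a' b' p'
  simp only [smul_mul_aux, mul_smul_aux, map_smul, smul_mul_assoc, mul_smul_comm,
    liftLinear_ofPath]
  congr 2
  by_cases h : a = b'
  · subst h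
    rw [ofPath_mul_ofPath_comp, liftLinear_ofPath, val_comp]
  · rw [ofPath_mul_ofPath_of_ne _ _ h, map_zero, D.val_mul_val_of_ne _ _ h]

@[simp]
theorem liftLinear_idem (a : V) : D.liftLinear k (idem k a) = D.e a :=
  D.liftLinear_ofPath _

@[simp]
theorem liftLinear_ofArrow {a b : V} (q : a ⟶ b) : D.liftLinear k (ofArrow k q) = D.x q := by
  rw [ofArrow, liftLinear_ofPath]
  change D.x q * D.e a = D.x q
  rw [D.x_mul_e]

variable [Fintype V]

theorem liftLinear_one : D.liftLinear k 1 = ∑ a, D.e a := by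
  rw [one_def, map_sum]
  simp

variable (k) in
/-- The algebra homomorphism given by lift data whose idempotents add up to one. -/
noncomputable def lift (h : ∑ a, D.e a = 1) : PathAlgebra k V →ₐ[k] A :=
  AlgHom.ofLinearMap (D.liftLinear k) (by rw [liftLinear_one, h]) D.liftLinear_mul

@[simp]
theorem lift_idem (h : ∑ a, D.e a = 1) (a : V) : D.lift k h (idem k a) = D.e a :=
  D.liftLinear_idem a

@[simp]
theorem lift_ofArrow (h : ∑ a, D.e a = 1) {a b : V} (q : a ⟶ b) :
    D.lift k h (ofArrow k q) = D.x q :=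
  D.liftLinear_ofArrow q

end LiftData

theorem idem_mul_idem (a b : V) : idem k a * idem k b = if a = b then idem k a else 0 := by
  split_ifs with h
  · subst h
    exact ofPath_mul_ofPath_comp _ _
  · exact ofPath_mul_ofPath_of_ne _ _ h

theorem idem_mul_ofPath {a b : V} (p : Quiver.Path a b) : idem k b * ofPath k p = ofPath k p := by
  rw [idem, ofPath_mul_ofPath_comp, Quiver.Path.comp_nil]

theorem ofPath_mul_idem {a b : V} (p : Quiver.Path a b) : ofPath k p * idem k a = ofPath k p := by
  rw [idem, ofPath_mul_ofPath_comp, Quiver.Path.nil_comp]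

theorem idem_mul_ofArrow {a b : V} (q : a ⟶ b) : idem k b * ofArrow k q = ofArrow k q :=
  idem_mul_ofPath _

theorem ofArrow_mul_idem {a b : V} (q : a ⟶ b) : ofArrow k q * idem k a = ofArrow k q :=
  ofPath_mul_idem _

theorem ofPath_cons {a b c : V} (p : Quiver.Path a b) (q : b ⟶ c) :
    ofPath k (p.cons q) = ofArrow k q * ofPath k p := by
  rw [ofArrow, ofPath_mul_ofPath_comp]
  rfl

/-- Induction on the generators of a path algebra. -/
@[elab_as_elim]
theorem generator_induction {motive : PathAlgebra k V → Prop} (x : PathAlgebra k V)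
    (zero : motive 0) (add : ∀ x y, motive x → motive y → motive (x + y))
    (smul : ∀ (c : k) x, motive x → motive (c • x))
    (mul : ∀ x y, motive x → motive y → motive (x * y))
    (idem : ∀ v, motive (idem k v))
    (arrow : ∀ (a b : V) (q : a ⟶ b), motive (ofArrow k q)) : motive x := by
  refine induction_on x zero add fun c a b p => smul c _ ?_
  induction p with
  | nil => exact idem a
  | cons p q ih =>
    rw [ofPath_cons]
    exact mul _ _ (arrow _ _ q) ih

variable [Fintype V]

theorem algHom_ext {A : Type v} [Ring A] [Algebra k A] {f g : PathAlgebra k V →ₐ[k] A}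
    (he : ∀ v, f (idem k v) = g (idem k v))
    (hx : ∀ (a b : V) (q : a ⟶ b), f (ofArrow k q) = g (ofArrow k q)) : f = g := by
  ext x
  refine generator_induction x ?_ ?_ ?_ ?_ he hx
  · simp
  · intro x y h₁ h₂
    simp [h₁, h₂]
  · intro c x h
    simp [h]
  · intro x y h₁ h₂
    simp [h₁, h₂]

end PathAlgebra

/-! ### Universal property of the one-point extension -/

namespace OnePointExtension

variable {k : Type u} [Field k] {A : Type u} [Ring A] [Algebra k A]
  {M : Type u} [AddCommGroup M] [Module k M] [Module Aᵐᵒᵖ M] [IsScalarTower k Aᵐᵒᵖ M]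

variable (k A M) in
/-- The matrix with the entries `a`, `m`, `c`. -/
def mk (a : A) (m : M) (c : k) : OnePointExtension k A M := ((a, m, c) : A × M × k)

theorem mk_mul_mk (a a' : A) (m m' : M) (c c' : k) : mk k A M a m c * mk k A M a' m' c' =
    mk k A M (a * a') (MulOpposite.op a' • m + c • m') (c * c') := rfl

theorem mk_add_mk (a a' : A) (m m' : M) (c c' : k) : mk k A M a m c + mk k A M a' m' c' =
    mk k A M (a + a') (m + m') (c + c') := rfl

theorem smul_mk (r : k) (a : A) (m : M) (c : k) :
    r • mk k A M a m c = mk k A M (r • a) (r • m) (r • c) := rfl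

theorem one_eq_mk : (1 : OnePointExtension k A M) = mk k A M 1 0 1 := rfl

theorem zero_eq_mk : (0 : OnePointExtension k A M) = mk k A M 0 0 0 := rfl

theorem exists_eq_mk (x : OnePointExtension k A M) : ∃ a m c, x = mk k A M a m c :=
  ⟨x.1, x.2.1, x.2.2, rfl⟩

variable (k A M) in
theorem finite [Module.Finite k A] [Module.Finite k M] :
    Module.Finite k (OnePointExtension k A M) :=
  inferInstanceAs (Module.Finite k (A × M × k))

/-- The universal property of the one-point extension. -/
def lift {C : Type v} [Ring C] [Algebra k C] (φ : A →ₗ[k] C) (ψ : M →ₗ[k] C) (f : C)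
    (hφ : ∀ a b, φ (a * b) = φ a * φ b) (hf : f * f = f) (hone : φ 1 + f = 1)
    (hψ : ∀ m, f * ψ m = ψ m) (hψφ : ∀ m a, ψ (MulOpposite.op a • m) = ψ m * φ a) :
    OnePointExtension k A M →ₐ[k] C :=
  -- `φ 1` and `f` are complementary idempotents; all vanishing products of matrix blocks follow
  -- from this.
  have h1 : φ 1 = 1 - f := eq_sub_of_add_eq hone
  have hfφ (a : A) : f * φ a = 0 := by
    rw [← one_mul a, hφ, h1, ← mul_assoc, mul_sub, hf, mul_one, sub_self, zero_mul]
  have hφf (a : A) : φ a * f = 0 := by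
    rw [← mul_one a, hφ, h1, mul_assoc, sub_mul, hf, one_mul, sub_self, mul_zero]
  have hφψ (a : A) (m : M) : φ a * ψ m = 0 := by
    rw [← hψ, ← mul_assoc, hφf, zero_mul]
  have hψf (m : M) : ψ m * f = 0 := by
    rw [← one_smul Aᵐᵒᵖ m, ← MulOpposite.op_one, hψφ, h1, mul_assoc, sub_mul, hf, one_mul,
      sub_self, mul_zero]
  have hψψ (m m' : M) : ψ m * ψ m' = 0 := by
    rw [← hψ m', ← mul_assoc, hψf, zero_mul]
  AlgHom.ofLinearMap
    (φ.coprod (ψ.coprod (LinearMap.toSpanSingleton k C f)) : A × M × k →ₗ[k] C)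
    (by
      change φ 1 + (ψ 0 + (1 : k) • f) = 1
      rw [map_zero, zero_add, one_smul, hone])
    (by
      rintro ⟨a, m, c⟩ ⟨a', m', c'⟩
      change φ (a * a') + (ψ (MulOpposite.op a' • m + c • m') + (c * c') • f) =
        (φ a + (ψ m + c • f)) * (φ a' + (ψ m' + c' • f))
      simp only [map_add, map_smul, hφ, hψφ, add_mul, mul_add, smul_mul_assoc, mul_smul_comm,
        hfφ, hφf, hφψ, hψf, hψψ, hψ, hf, smul_zero, zero_add, add_zero, mul_smul]
      rw [smul_comm c c', add_assoc, add_assoc])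

end OnePointExtension

/-! ### Vanishing of extensions from projective resolutions -/

section Ext

open CategoryTheory CategoryTheory.Abelian

variable {R : Type u} [Ring R]

theorem ModuleCat.ext_subsingleton_of_projective (P N : Type u) [AddCommGroup P] [Module R P]
    [Module.Projective R P] [AddCommGroup N] [Module R N] (n : ℕ) (hn : 0 < n) :
    Subsingleton (Ext (ModuleCat.of R P) (ModuleCat.of R N) n) := by
  obtain ⟨n, rfl⟩ := Nat.exists_eq_succ_of_ne_zero hn.ne'
  have : Projective (ModuleCat.of R P) :=
    (IsProjective.iff_projective (R := R) (P := P)).1 inferInstance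
  exact Ext.subsingleton_of_projective _ _ _

/-- A module with a projective resolution of length one has no higher extensions with those
modules to which the homomorphisms on the first syzygy extend. -/
theorem ModuleCat.ext_subsingleton_of_resolution {P Q M N : Type u} [AddCommGroup P] [Module R P]
    [Module.Projective R P] [AddCommGroup Q] [Module R Q] [Module.Projective R Q]
    [AddCommGroup M] [Module R M] [AddCommGroup N] [Module R N] (i : P →ₗ[R] Q) (q : Q →ₗ[R] M)
    (hi : Function.Injective i) (hiq : Function.Exact i q) (hq : Function.Surjective q)
    (hext : ∀ h : P →ₗ[R] N, ∃ h' : Q →ₗ[R] N, h' ∘ₗ i = h) (n : ℕ) (hn : 0 < n) :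
    Subsingleton (Ext (ModuleCat.of R M) (ModuleCat.of R N) n) := by
  let S : ShortComplex (ModuleCat.{u} R) := ShortComplex.mk (ModuleCat.ofHom i)
    (ModuleCat.ofHom q) (by
      ext x
      exact hiq.apply_apply_eq_zero x)
  have hS : S.ShortExact :=
    { exact := (ShortComplex.ShortExact.moduleCat_exact_iff_function_exact S).2 hiq
      mono_f := (ModuleCat.mono_iff_injective _).2 hi
      epi_g := (ModuleCat.epi_iff_surjective _).2 hq }
  obtain ⟨n, rfl⟩ := Nat.exists_eq_succ_of_ne_zero hn.ne'
  refine subsingleton_of_forall_eq 0 fun x => ?_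
  have hQ := ModuleCat.ext_subsingleton_of_projective (R := R) Q N (n + 1) hn
  -- The class dies on the projective `Q`, so by the long exact sequence it is the extension class
  -- of the resolution composed with some `y` in `Ext^n(P, N)`.
  obtain ⟨y, rfl⟩ := Ext.contravariant_sequence_exact₃ hS (ModuleCat.of R N) x
    (hQ.elim _ _) (add_comm 1 n)
  -- In degree zero `y` is a homomorphism that factors through `i`, and the extension class composed
  -- with `i` is zero. In positive degree `y` itself vanishes, as `P` is projective.
  rcases Nat.eq_zero_or_pos n with rfl | hn'
  · obtain ⟨h, rfl⟩ := (Ext.mk₀_bijective _ _).2 y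
    obtain ⟨h', hh'⟩ := hext h.hom
    have : h = S.f ≫ ModuleCat.ofHom h' := by
      ext x
      exact (LinearMap.congr_fun hh' x).symm
    rw [this, ← Ext.mk₀_comp_mk₀, ← Ext.comp_assoc (h₁₂ := by rfl) (h₂₃ := by rfl) (h := by rfl),
      hS.extClass_comp, Ext.zero_comp]
  · have hP := ModuleCat.ext_subsingleton_of_projective (R := R) P N n hn'
    rw [hP.elim y 0, Ext.comp_zero]

end Ext

/-! ### The projective modules `e B` and their exceptionality -/

section IdemModule

open MulOpposite

/-- The right module `e B`, for an idempotent `e` of the ring `B`. -/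
def idemModule {B : Type u} [Ring B] (e : B) : Submodule Bᵐᵒᵖ B where
  carrier := {x | e * x = x}
  zero_mem' := mul_zero e
  add_mem' := by
    intro x y (hx : e * x = x) (hy : e * y = y)
    change e * (x + y) = x + y
    rw [mul_add, hx, hy]
  smul_mem' := by
    intro b x (hx : e * x = x)
    change e * (x * b.unop) = x * b.unop
    rw [← mul_assoc, hx]

theorem mem_idemModule {B : Type u} [Ring B] {e x : B} : x ∈ idemModule e ↔ e * x = x := Iff.rfl

instance projective_mulOpposite_self (B : Type u) [Ring B] : Module.Projective Bᵐᵒᵖ B :=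
  let e : Bᵐᵒᵖ ≃ₗ[Bᵐᵒᵖ] B :=
    { opEquiv.symm with
      map_add' := fun _ _ => rfl
      map_smul' := fun _ _ => rfl }
  Module.Projective.of_equiv e

theorem idemModule_projective {B : Type u} [Ring B] {e : B} (he : e * e = e) :
    Module.Projective Bᵐᵒᵖ (idemModule e) :=
  Module.Projective.of_split (idemModule e).subtype
    { toFun := fun b => ⟨e * b, by rw [mem_idemModule, ← mul_assoc, he]⟩
      map_add' := fun x y => Subtype.ext (mul_add e x y)
      map_smul' := fun b x => Subtype.ext (mul_assoc e x b.unop).symm }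
    (by
      ext x
      exact x.2)

/-- An endomorphism of `e B` is determined by the image of `e`, which lies in `e B e`. By `hend`
this space is the line through `e`, so only scalars remain. Extensions vanish by projectivity. -/
theorem isExceptionalModule_idemModule (k : Type u) [Field k] {B : Type u} [Ring B] [Algebra k B]
    [Module.Finite k B] {e : B} (he : e * e = e) (he0 : e ≠ 0)
    (hend : ∀ b, ∃ c : k, e * b * e = c • e) : IsExceptionalModule k B (idemModule e) where
  finite := Module.Finite.of_injective ((idemModule e).subtype.restrictScalars k)
    Subtype.val_injective
  end_eq := by
    let g : idemModule e := ⟨e, he⟩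
    constructor
    · intro c d h
      have h' : c • e = d • e := congrArg Subtype.val (LinearMap.congr_fun h g)
      exact smul_left_injective k he0 h'
    · intro φ
      obtain ⟨c, hc⟩ := hend (φ g)
      have hg : op e • g = g := Subtype.ext he
      have h1 : ((φ g : idemModule e) : B) = c • e := by
        have h2 : op e • φ g = φ g := by rw [← map_smul, hg]
        rw [← hc, (φ g).2]
        exact (congrArg Subtype.val h2).symm
      refine ⟨c, LinearMap.ext fun x => Subtype.ext ?_⟩
      have hx : op (x : B) • g = x := Subtype.ext x.2
      rw [← hx, map_smul φ]
      change c • (e * (x : B)) = (φ g : B) * (x : B)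
      rw [h1, smul_mul_assoc]
  ext_eq_zero := fun n hn => by
    have := idemModule_projective he
    exact ModuleCat.ext_subsingleton_of_projective _ _ n hn

end IdemModule

namespace OnePointExtension

variable {k : Type u} [Field k] {A : Type u} [Ring A] [Algebra k A]
  {M : Type u} [AddCommGroup M] [Module k M] [Module Aᵐᵒᵖ M] [IsScalarTower k Aᵐᵒᵖ M]

theorem mk_eq_add (a : A) (m : M) (c : k) :
    mk k A M a m c = mk k A M a 0 0 + (mk k A M 0 m 0 + c • mk k A M 0 0 1) := by
  simp [mk_add_mk, smul_mk]

variable (k A M) in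
/-- The embedding of `A` into a one-point extension. -/
def inl : A →ₗ[k] OnePointExtension k A M where
  toFun a := mk k A M a 0 0
  map_add' a b := by simp [mk_add_mk]
  map_smul' c a := by simp [smul_mk]

variable (k A M) in
/-- The embedding of `M` into a one-point extension. -/
def inr : M →ₗ[k] OnePointExtension k A M where
  toFun m := mk k A M 0 m 0
  map_add' a b := by simp [mk_add_mk]
  map_smul' c a := by simp [smul_mk]

theorem inl_apply (a : A) : inl k A M a = mk k A M a 0 0 := rfl

theorem algHom_ext {C : Type v} [Ring C] [Algebra k C] {f g : OnePointExtension k A M →ₐ[k] C}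
    (h₁ : ∀ a, f (mk k A M a 0 0) = g (mk k A M a 0 0))
    (h₂ : ∀ m, f (mk k A M 0 m 0) = g (mk k A M 0 m 0))
    (h₃ : f (mk k A M 0 0 1) = g (mk k A M 0 0 1)) : f = g := by
  ext x
  obtain ⟨a, m, c, rfl⟩ := exists_eq_mk x
  rw [mk_eq_add]
  simp only [map_add, map_smul, h₁, h₂, h₃]

end OnePointExtension

/-! ### Splitting off a leaf: path algebras of rooted trees are accessible -/

namespace PathAlgebra

/-- The vertices other than `ω` of a quiver. -/
structure VertexDeletion {V : Type} (ω : V) : Type where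
  val : V
  ne : val ≠ ω
  deriving DecidableEq

namespace VertexDeletion

/-- The vertices other than `ω` as a subtype. -/
def equivSubtype {V : Type} (ω : V) : {v : V // v ≠ ω} ≃ VertexDeletion ω where
  toFun v := ⟨v.1, v.2⟩
  invFun v := ⟨v.1, v.2⟩

instance {V : Type} [DecidableEq V] [Fintype V] (ω : V) : Fintype (VertexDeletion ω) :=
  Fintype.ofEquiv _ (equivSubtype ω)

/-- The full subquiver of the vertices other than `ω`. -/
instance {V : Type} [Quiver.{0} V] (ω : V) : Quiver.{0} (VertexDeletion ω) :=
  ⟨fun a b => a.val ⟶ b.val⟩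

/-- An arrow between vertices other than `ω`, as an arrow of the full subquiver. -/
def restrict {V : Type} [Quiver.{0} V] {ω a b : V} (ha : a ≠ ω) (hb : b ≠ ω) (q : a ⟶ b) :
    (⟨a, ha⟩ : VertexDeletion ω) ⟶ ⟨b, hb⟩ := q

end VertexDeletion

theorem idem_ne_zero (k : Type u) [Field k] {V : Type} [Quiver.{0} V] (v : V) : idem k v ≠ 0 :=
  (basis k V).ne_zero ⟨v, v, Quiver.Path.nil⟩

variable {k : Type u} [Field k] {V : Type} [Quiver.{0} V] [DecidableEq V] [Fintype V]

omit [DecidableEq V] [Fintype V] in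
theorem le_of_path (r : V → ℕ) (hr : ∀ a b : V, (a ⟶ b) → r a < r b) {a b : V}
    (p : Quiver.Path a b) : r a ≤ r b := by
  induction p with
  | nil => exact le_rfl
  | cons p q ih => exact ih.trans (hr _ _ q).le

/-- The rank `r` grows along arrows, so a closed path is trivial. This supplies the hypothesis on
the endomorphisms of `e_v B` in `isExceptionalModule_idemModule`. -/
theorem idem_mul_mul_idem (r : V → ℕ) (hr : ∀ a b : V, (a ⟶ b) → r a < r b) (v : V)
    (x : PathAlgebra k V) : ∃ c : k, idem k v * x * idem k v = c • idem k v := by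
  refine induction_on x ⟨0, by simp⟩ ?_ ?_
  · rintro x y ⟨c, hc⟩ ⟨d, hd⟩
    exact ⟨c + d, by rw [mul_add, add_mul, hc, hd, add_smul]⟩
  · intro c a b p
    by_cases hb : v = b
    · by_cases ha : a = v
      · subst hb ha
        have hp : p = Quiver.Path.nil := by
          cases p with
          | nil => rfl
          | cons p q => exact absurd (hr _ _ q) (le_of_path r hr p).not_gt
        subst hp
        refine ⟨c, ?_⟩
        change idem k a * c • idem k a * idem k a = _
        rw [mul_smul_comm, smul_mul_assoc, idem_mul_idem, if_pos rfl, idem_mul_idem, if_pos rfl]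
      · refine ⟨0, ?_⟩
        rw [mul_assoc, smul_mul_assoc, idem, ofPath_mul_ofPath_of_ne _ _ ha]
        simp
    · refine ⟨0, ?_⟩
      rw [mul_smul_comm, idem, ofPath_mul_ofPath_of_ne _ _ hb]
      simp

section Deletion

open MulOpposite OnePointExtension

variable {ω : V}

omit [Quiver.{0} V] in
theorem sum_vertexDeletion {A : Type v} [AddCommMonoid A] (f : V → A) (ω : V) :
    ∑ v, f v = ∑ v : VertexDeletion ω, f v.val + f ω := by
  rw [Fintype.sum_eq_add_sum_subtype_ne _ ω, add_comm,
    ← (VertexDeletion.equivSubtype ω).sum_comp]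
  rfl

variable (k) in
/-- The images of the generators of the path algebra of the full subquiver. -/
noncomputable def deletionData (ω : V) : LiftData (VertexDeletion ω) (PathAlgebra k V) where
  e v := idem k v.val
  x {a b} q := ofArrow k (a := a.val) (b := b.val) q
  e_mul_e a b := by
    rw [idem_mul_idem]
    exact if_congr (by cases a; cases b; simp) rfl rfl
  e_mul_x q := idem_mul_ofArrow _
  x_mul_e q := ofArrow_mul_idem _

variable {u : VertexDeletion ω}

theorem idem_mem_idemModule (u : VertexDeletion ω) :
    idem k u ∈ idemModule (idem k u) := by
  rw [mem_idemModule, idem_mul_idem, if_pos rfl]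

/-- The images of the generators of a path algebra in a one-point extension of the path algebra
of the quiver without the sink `ω`, which is the target of arrows from `u` only. -/
noncomputable def extensionData (hω : ∀ b, IsEmpty (ω ⟶ b)) (hu : ∀ a, (a ⟶ ω) → a = u.val) :
    LiftData V (OnePointExtension k (PathAlgebra k (VertexDeletion ω))
      (idemModule (idem k u))) where
  e v := if h : v = ω then mk _ _ _ 0 0 1 else mk _ _ _ (idem k ⟨v, h⟩) 0 0
  x {a b} q := if hb : b = ω then mk _ _ _ 0 ⟨idem k u, idem_mem_idemModule u⟩ 0 else
    -- No arrow starts at `ω`, so the value `0` is a default that never matters.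
    if ha : a = ω then 0 else mk _ _ _ (ofArrow k (VertexDeletion.restrict ha hb q)) 0 0
  e_mul_e a b := by
    by_cases ha : a = ω
    · by_cases hb : b = ω
      · subst ha hb
        simp [mk_mul_mk]
      · subst ha
        rw [if_neg (Ne.symm hb), dif_pos rfl, dif_neg hb]
        simp [mk_mul_mk, zero_eq_mk]
    · by_cases hb : b = ω
      · subst hb
        rw [if_neg ha, dif_neg ha, dif_pos rfl]
        simp [mk_mul_mk, zero_eq_mk]
      · rw [dif_neg ha, dif_neg hb, mk_mul_mk, idem_mul_idem]
        by_cases hab : a = b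
        · subst hab
          simp
        · simp [hab, zero_eq_mk]
  e_mul_x {a b} q := by
    by_cases hb : b = ω
    · subst hb
      simp [mk_mul_mk]
    · have ha : a ≠ ω := by
        rintro rfl
        exact (hω b).false q
      rw [dif_neg hb, dif_neg hb, dif_neg ha, mk_mul_mk, idem_mul_ofArrow]
      simp
  x_mul_e {a b} q := by
    by_cases hb : b = ω
    · subst hb
      obtain rfl := hu a q
      rw [dif_pos rfl, dif_neg u.ne, mk_mul_mk]
      have : op (idem k u) • (⟨idem k u, idem_mem_idemModule u⟩ : idemModule (idem k u)) =
          ⟨idem k u, idem_mem_idemModule u⟩ := Subtype.ext (idem_mem_idemModule u)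
      simp [this]
    · have ha : a ≠ ω := by
        rintro rfl
        exact (hω b).false q
      rw [dif_neg hb, dif_neg ha, dif_neg ha, mk_mul_mk, ofArrow_mul_idem]
      simp

section

variable (hω : ∀ b, IsEmpty (ω ⟶ b)) (hu : ∀ a, (a ⟶ ω) → a = u.val)

theorem extensionData_e_sink : (extensionData (k := k) hω hu).e ω = mk _ _ _ 0 0 1 :=
  dif_pos rfl

theorem extensionData_e (v : VertexDeletion ω) :
    (extensionData (k := k) hω hu).e v.val = mk _ _ _ (idem k v) 0 0 :=
  dif_neg v.ne

theorem extensionData_x_sink {a : V} (q : a ⟶ ω) : (extensionData (k := k) hω hu).x q =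
    mk _ _ _ 0 ⟨idem k u, idem_mem_idemModule u⟩ 0 :=
  dif_pos rfl

theorem extensionData_x {a b : VertexDeletion ω} (q : a ⟶ b) :
    (extensionData (k := k) hω hu).x (a := a.val) (b := b.val) q = mk _ _ _ (ofArrow k q) 0 0 :=
  (dif_neg b.ne).trans (dif_neg a.ne)

theorem sum_extensionData : ∑ v, (extensionData (k := k) hω hu).e v = 1 := by
  rw [sum_vertexDeletion _ ω, extensionData_e_sink]
  simp only [extensionData_e, ← inl_apply]
  rw [← map_sum, ← one_def, inl_apply, mk_add_mk]
  simp [one_eq_mk]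

theorem deletionData_liftLinear_one :
    (deletionData k ω).liftLinear k 1 + idem k ω = 1 := by
  rw [LiftData.liftLinear_one, one_def, sum_vertexDeletion _ ω]
  rfl

/-- The inclusion of `e_u B` into the path algebra, by means of an arrow from `u` to `ω`. -/
noncomputable def arrowMul (y : u.val ⟶ ω) : idemModule (idem k u) →ₗ[k] PathAlgebra k V :=
  (LinearMap.mulLeft k (ofArrow k y)) ∘ₗ (deletionData k ω).liftLinear k ∘ₗ
      (idemModule (idem k u)).subtype.restrictScalars k

theorem arrowMul_apply (y : u.val ⟶ ω) (m : idemModule (idem k u)) :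
    arrowMul y m = ofArrow k y * (deletionData k ω).liftLinear k m.1 := rfl

/-- The homomorphism from the one-point extension to the path algebra. -/
noncomputable def ofExtension (y : u.val ⟶ ω) :
    OnePointExtension k (PathAlgebra k (VertexDeletion ω)) (idemModule (idem k u)) →ₐ[k]
      PathAlgebra k V :=
  OnePointExtension.lift ((deletionData k ω).liftLinear k) (arrowMul y)
    (idem k ω) (deletionData k ω).liftLinear_mul ((idem_mul_idem _ _).trans (if_pos rfl))
    deletionData_liftLinear_one
    (fun m => by rw [arrowMul_apply, ← mul_assoc, idem_mul_ofArrow])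
    (fun m b => by
      rw [arrowMul_apply, arrowMul_apply, mul_assoc, ← LiftData.liftLinear_mul]
      rfl)

theorem ofExtension_mk (y : u.val ⟶ ω) (b) (m : idemModule (idem k u)) (c : k) :
    ofExtension y (mk _ _ _ b m c) = (deletionData k ω).liftLinear k b +
      (ofArrow k y * (deletionData k ω).liftLinear k m.1 + c • idem k ω) := rfl

/-- The homomorphism from the path algebra to the one-point extension. -/
noncomputable def toExtension : PathAlgebra k V →ₐ[k]
    OnePointExtension k (PathAlgebra k (VertexDeletion ω)) (idemModule (idem k u)) :=
  (extensionData hω hu).lift k (sum_extensionData hω hu)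

theorem toExtension_idem (v : V) :
    toExtension hω hu (idem k v) = (extensionData hω hu).e v :=
  LiftData.lift_idem _ _ _

theorem toExtension_ofArrow {a b : V} (q : a ⟶ b) :
    toExtension hω hu (ofArrow k q) = (extensionData hω hu).x q :=
  LiftData.lift_ofArrow _ _ _

theorem toExtension_deletionData (b : PathAlgebra k (VertexDeletion ω)) :
    toExtension hω hu ((deletionData k ω).liftLinear k b) = mk _ _ _ b 0 0 := by
  refine generator_induction b ?_ ?_ ?_ ?_ ?_ ?_
  · simp [zero_eq_mk]
  · intro x y hx hy
    simp [hx, hy, mk_add_mk]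
  · intro c x hx
    simp [hx, smul_mk]
  · intro x y hx hy
    simp [LiftData.liftLinear_mul, hx, hy, mk_mul_mk]
  · intro v
    rw [LiftData.liftLinear_idem]
    exact (toExtension_idem _ _ _).trans (extensionData_e _ _ _)
  · intro a b q
    rw [LiftData.liftLinear_ofArrow]
    exact (toExtension_ofArrow _ _ _).trans (extensionData_x _ _ _)

theorem toExtension_comp_ofExtension (y : u.val ⟶ ω) :
    (toExtension hω hu).comp (ofExtension (k := k) y) = AlgHom.id k _ := by
  apply OnePointExtension.algHom_ext
  · intro a
    rw [AlgHom.comp_apply, ofExtension_mk]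
    simp [toExtension_deletionData]
  · intro m
    rw [AlgHom.comp_apply, ofExtension_mk]
    have h3 : op (m : PathAlgebra k (VertexDeletion ω)) •
        (⟨idem k u, idem_mem_idemModule u⟩ : idemModule (idem k u)) = m :=
      Subtype.ext m.2
    simp [toExtension_deletionData, toExtension_ofArrow, extensionData_x_sink, mk_mul_mk, h3]
  · rw [AlgHom.comp_apply, ofExtension_mk]
    simp [toExtension_idem, extensionData_e_sink]

/-- All arrows ending at `ω` have the same image in the one-point extension, so this composite can
only be the identity because `y` is the unique such arrow. -/
theorem ofExtension_comp_toExtension (y : u.val ⟶ ω)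
    (hy : ∀ z : Σ a, (a ⟶ ω), z = ⟨u.val, y⟩) :
    (ofExtension (k := k) y).comp (toExtension hω hu) = AlgHom.id k _ := by
  apply PathAlgebra.algHom_ext
  · intro v
    rw [AlgHom.comp_apply, toExtension_idem]
    by_cases hv : v = ω
    · subst hv
      rw [extensionData_e_sink, ofExtension_mk]
      simp
    · rw [extensionData_e hω hu ⟨v, hv⟩, ofExtension_mk]
      simp [deletionData]
  · intro a b q
    rw [AlgHom.comp_apply, toExtension_ofArrow]
    by_cases hb : b = ω
    · subst hb
      obtain rfl : a = u.val := hu a q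
      obtain rfl : q = y := eq_of_heq (Sigma.ext_iff.1 (hy ⟨_, q⟩)).2
      rw [extensionData_x_sink, ofExtension_mk]
      simp [deletionData, ofArrow_mul_idem]
    · have ha : a ≠ ω := by
        rintro rfl
        exact (hω b).false q
      refine (congrArg _ (extensionData_x hω hu (VertexDeletion.restrict ha hb q))).trans ?_
      rw [ofExtension_mk, LiftData.liftLinear_ofArrow]
      simp [deletionData]
      rfl

/-- A path algebra as a one-point extension, for a sink which is the target of one arrow only. -/
noncomputable def extensionEquiv (y : u.val ⟶ ω)
    (hy : ∀ z : Σ a, (a ⟶ ω), z = ⟨u.val, y⟩) :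
    PathAlgebra k V ≃ₐ[k] OnePointExtension k (PathAlgebra k (VertexDeletion ω))
      (idemModule (idem k u)) :=
  AlgEquiv.ofAlgHom (toExtension hω hu) (ofExtension y)
    (toExtension_comp_ofExtension hω hu y) (ofExtension_comp_toExtension hω hu y hy)

end

end Deletion

/-- The path algebra of a rooted tree, with all arrows pointing away from the root, is
accessible. -/
theorem isAccessible_of_tree (k : Type u) [Field k] (n : ℕ) :
    ∀ (V : Type) [Quiver.{0} V] [DecidableEq V] [Fintype V] (r : V → ℕ)
      (_ : ∀ a b : V, (a ⟶ b) → r a < r b) (c : V) (_ : ∀ a, IsEmpty (a ⟶ c))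
      (_ : ∀ v, v ≠ c → ∃ z : Σ a, (a ⟶ v), ∀ z', z' = z) (_ : Fintype.card V = n + 1),
      IsAccessible k (PathAlgebra k V) ∧ Module.Finite k (PathAlgebra k V) := by
  -- Finite dimension is carried along because it is part of the exceptionality of the module used
  -- in the next extension.
  induction n with
  | zero =>
    intro V _ _ _ r hr c hc hp hV
    have hV' : ∀ v, v = c := fun v => (Fintype.card_le_one_iff.1 hV.le) v c
    let D : LiftData V k :=
      { e := fun _ => 1
        x := fun _ => 0
        e_mul_e := fun a b => by simp [hV' a, hV' b]
        e_mul_x := by simp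
        x_mul_e := by simp }
    have hD : ∑ v, D.e v = 1 := by simp [D, hV]
    have hone : (1 : PathAlgebra k V) = idem k c := by
      rw [one_def, Finset.sum_eq_single c] <;> simp [hV']
    let e : PathAlgebra k V ≃ₐ[k] k := AlgEquiv.ofAlgHom (D.lift k hD) (Algebra.ofId k _)
      (by ext)
      (by
        apply algHom_ext
        · intro v
          simp [D, hV' v, hone]
        · intro a b q
          obtain rfl := hV' b
          exact ((hc a).false q).elim)
    exact ⟨.base e, Module.Finite.equiv e.symm.toLinearEquiv⟩
  | succ n ih =>
    intro V _ _ _ r hr c hc hp hV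
    have hne : (Finset.univ.erase c).Nonempty := by
      rw [← Finset.card_pos, Finset.card_erase_of_mem (Finset.mem_univ c), Finset.card_univ, hV]
      simp
    obtain ⟨ω, hωc, hmax⟩ := Finset.exists_max_image _ r hne
    have hωc : ω ≠ c := Finset.ne_of_mem_erase hωc
    -- A vertex of maximal rank among those other than the root is a leaf: an arrow from it would
    -- lead to a vertex of larger rank, which could only be the root, and no arrow ends there.
    have hω (b) : IsEmpty (ω ⟶ b) := by
      refine ⟨fun q => (hr _ _ q).not_ge (hmax b (Finset.mem_erase.2 ⟨?_, Finset.mem_univ b⟩))⟩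
      rintro rfl
      exact (hc ω).false q
    obtain ⟨⟨u, y⟩, hy⟩ := hp ω hωc
    have huω : u ≠ ω := by
      rintro rfl
      exact (hω u).false y
    have hu (a) (q : a ⟶ ω) : a = u := congrArg Sigma.fst (hy ⟨a, q⟩)
    have hr' (a b : VertexDeletion ω) (q : a ⟶ b) : r a.val < r b.val := hr _ _ q
    obtain ⟨h1, h2⟩ := ih (VertexDeletion ω) (fun v => r v.val) hr'
      ⟨c, hωc.symm⟩ (fun a => hc a.val)
      -- As `ω` is a leaf, it is the parent of no vertex; hence every other vertex besides the root
      -- keeps its unique incoming arrow.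
      (by
        rintro ⟨v, hv⟩ hvc
        obtain ⟨⟨a, q⟩, hq⟩ := hp v (fun h => hvc (by subst h; rfl))
        have ha : a ≠ ω := by
          rintro rfl
          exact (hω v).false q
        refine ⟨⟨⟨a, ha⟩, q⟩, ?_⟩
        rintro ⟨⟨a', ha'⟩, q'⟩
        obtain ⟨rfl, h⟩ := Sigma.ext_iff.1 (hq ⟨a', q'⟩)
        obtain rfl := eq_of_heq h
        rfl)
      (by
        rw [← Fintype.card_congr (VertexDeletion.equivSubtype ω), Fintype.card_subtype_compl, hV]
        simp)
    have hE := isExceptionalModule_idemModule k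
      ((idem_mul_idem (k := k) (⟨u, huω⟩ : VertexDeletion ω) ⟨u, huω⟩).trans (if_pos rfl))
      (idem_ne_zero k _) (idem_mul_mul_idem _ hr' _)
    have e := extensionEquiv (k := k) (u := ⟨u, huω⟩) hω hu y hy
    have := hE.finite
    have := OnePointExtension.finite k (PathAlgebra k (VertexDeletion ω))
      (idemModule (idem k (⟨u, huω⟩ : VertexDeletion ω)))
    exact ⟨.extension h1 _ hE e, Module.Finite.equiv e.symm.toLinearEquiv⟩

end PathAlgebra

/-! ### Right modules over the star with lines at the arms -/

section StarRepresentations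

open MulOpposite

namespace StarVertex

variable {t : ℕ} {p : Fin t → ℕ}

/-- The `j`-th arrow (counted from `0`) of the `i`-th arm of the star. -/
def arrow (i : Fin t) (j : Fin (p i - 1)) : src p i j ⟶ arm i j := ⟨⟨i, j⟩, rfl, rfl⟩

/-- The rank function of the star: the distance from the center. -/
def height : StarVertex p → ℕ
  | center => 0
  | arm _ j => j.val + 1

theorem height_src (i : Fin t) (j : Fin (p i - 1)) : height (src p i j) = j.val := by
  unfold src
  split_ifs with h
  · exact h.symm
  · simp only [height]
    omega

theorem height_lt {a b : StarVertex p} (q : a ⟶ b) : height a < height b := by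
  obtain ⟨⟨i, j⟩, rfl, rfl⟩ := q
  rw [height_src]
  exact Nat.lt_succ_self _

theorem isEmpty_hom_center (a : StarVertex p) : IsEmpty (a ⟶ center) :=
  ⟨fun q => by cases q.2.2⟩

theorem isAccessible (k : Type u) [Field k] :
    IsAccessible k (PathAlgebra k (StarVertex p)) ∧
      Module.Finite k (PathAlgebra k (StarVertex p)) := by
  have : Nonempty (StarVertex p) := ⟨center⟩
  obtain ⟨n, hn⟩ := Nat.exists_eq_succ_of_ne_zero (Fintype.card_ne_zero (α := StarVertex p))
  refine PathAlgebra.isAccessible_of_tree k n _ height (fun _ _ => height_lt) center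
    isEmpty_hom_center ?_ hn
  rintro (_ | ⟨i, j⟩) hv
  · exact absurd rfl hv
  · refine ⟨⟨_, arrow i j⟩, ?_⟩
    rintro ⟨a, ⟨⟨i', j'⟩, rfl, h⟩⟩
    obtain ⟨rfl, h⟩ := arm.inj h
    obtain rfl := eq_of_heq h
    rfl

/-- The vertices of the star as the center and the vertices of the arms. -/
def optionEquiv : Option (Σ i, Fin (p i - 1)) ≃ StarVertex p where
  toFun
    | none => center
    | some a => arm a.1 a.2
  invFun
    | center => none
    | arm i j => some ⟨i, j⟩
  left_inv := by rintro (_ | a) <;> rfl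
  right_inv := by rintro (_ | _) <;> rfl

theorem sum_eq {A : Type v} [AddCommMonoid A] (f : StarVertex p → A) :
    ∑ v, f v = f center + ∑ a : Σ i, Fin (p i - 1), f (arm a.1 a.2) := by
  rw [← optionEquiv.sum_comp, Fintype.sum_option]
  rfl

end StarVertex

open StarVertex PathAlgebra

/-- Used to choose a vector at the far end of an arm and transport it back to the center along the
arrows. Sequences on all of `ℕ` avoid dependent indices. -/
theorem exists_backward_sequence {N : Type v} (X : ℕ → N → N) (n : ℕ) (a : N) :
    ∃ s : ℕ → N, s n = a ∧ ∀ j < n, s j = X j (s (j + 1)) := by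
  induction n generalizing a with
  | zero => exact ⟨fun _ => a, rfl, by simp⟩
  | succ n ih =>
    obtain ⟨s, hs, h⟩ := ih (X n a)
    refine ⟨fun j => if j ≤ n then s j else a, by simp, fun j hj => ?_⟩
    rcases Nat.lt_succ_iff_lt_or_eq.1 hj with hj | rfl
    · simp [hj.le, Nat.succ_le_of_lt hj, h j hj]
    · simp [hs]

section StarRep

variable {k : Type u} [Field k] {t : ℕ} {p : Fin t → ℕ} {W : Type u} [AddCommGroup W] [Module k W]

/-- The vector space with the space `W` at the center and the space `k` at the other vertices of
the star. -/
abbrev StarSpace (k : Type u) {t : ℕ} (p : Fin t → ℕ) (W : Type u) : Type u :=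
  W × ((Σ i, Fin (p i - 1)) → k)

namespace StarSpace

variable (k p W) in
/-- The projection to a vertex. -/
def vertexEnd : StarVertex p → Module.End k (StarSpace k p W)
  | center => LinearMap.inl k W _ ∘ₗ LinearMap.fst k W _
  | arm i j => LinearMap.inr k W _ ∘ₗ LinearMap.single k (fun _ => k) ⟨i, j⟩ ∘ₗ
      LinearMap.proj ⟨i, j⟩ ∘ₗ LinearMap.snd k W _

theorem vertexEnd_center_eq : vertexEnd k p W center =
    LinearMap.inl k W _ ∘ₗ LinearMap.fst k W _ := rfl

theorem vertexEnd_arm_eq (i : Fin t) (j : Fin (p i - 1)) : vertexEnd k p W (arm i j) =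
    LinearMap.inr k W _ ∘ₗ LinearMap.single k (fun _ => k) ⟨i, j⟩ ∘ₗ
      LinearMap.proj ⟨i, j⟩ ∘ₗ LinearMap.snd k W _ := rfl

theorem vertexEnd_center (x : StarSpace k p W) : vertexEnd k p W center x = (x.1, 0) := rfl

theorem vertexEnd_arm (i : Fin t) (j : Fin (p i - 1)) (x : StarSpace k p W) :
    vertexEnd k p W (arm i j) x = (0, Pi.single ⟨i, j⟩ (x.2 ⟨i, j⟩)) := rfl

variable (p) in
/-- The standard vector at the `j`-th vertex of the `i`-th arm, where the center is the vertex
number zero. -/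
def gen (g : Fin t → W) (i : Fin t) : ℕ → StarSpace k p W
  | 0 => (g i, 0)
  | j + 1 => if h : j < p i - 1 then (0, Pi.single ⟨i, j, h⟩ 1) else 0

omit [Module k W] in
theorem gen_succ (g : Fin t → W) (i : Fin t) (j : Fin (p i - 1)) :
    gen (k := k) p g i (j.val + 1) = (0, Pi.single ⟨i, j⟩ 1) := dif_pos j.2

variable (p) in
/-- The action of the arrow with the end `a`. -/
def arrowEnd (g : Fin t → W) (a : Σ i, Fin (p i - 1)) : Module.End k (StarSpace k p W) :=
  LinearMap.toSpanSingleton k _ (gen p g a.1 a.2) ∘ₗ LinearMap.proj a ∘ₗ LinearMap.snd k W _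

theorem arrowEnd_apply (g : Fin t → W) (a : Σ i, Fin (p i - 1)) (x : StarSpace k p W) :
    arrowEnd p g a x = x.2 a • gen p g a.1 a.2 := rfl

/-- The standard vector number `j` sits at the source of the arrow number `j`, the center being
number zero. This shift by one runs through all later formulas. -/
theorem vertexEnd_src_gen (g : Fin t → W) (i : Fin t) (j : Fin (p i - 1)) :
    vertexEnd k p W (src p i j) (gen p g i j) = gen p g i j := by
  obtain ⟨_ | j, hj⟩ := j
  · rfl
  · have h : j < p i - 1 := by omega
    have h1 : src p i ⟨j + 1, hj⟩ = arm i ⟨j, h⟩ := by simp [src]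
    rw [h1, vertexEnd_arm]
    simp [gen, h]

/-- The generators of the path algebra of the star as endomorphisms. -/
def liftData (g : Fin t → W) : LiftData (StarVertex p) (Module.End k (StarSpace k p W))ᵐᵒᵖ where
  e v := op (vertexEnd k p W v)
  x q := op (arrowEnd p g q.1)
  e_mul_e a b := by
    rw [← op_mul, ← op_zero, ← apply_ite op]
    congr 1
    refine LinearMap.ext fun x => ?_
    rw [Module.End.mul_apply]
    rcases a with _ | ⟨i, j⟩ <;> rcases b with _ | ⟨i', j'⟩
    · rfl
    · rw [if_neg (by simp), vertexEnd_center, vertexEnd_arm]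
      simp
    · rw [if_neg (by simp), vertexEnd_center, vertexEnd_arm]
      simp
    · rw [vertexEnd_arm, vertexEnd_arm]
      by_cases h : arm i j = arm i' j'
      · obtain ⟨rfl, h'⟩ := arm.inj h
        obtain rfl := eq_of_heq h'
        rw [if_pos rfl, vertexEnd_arm]
        simp
      · have h' : (⟨i', j'⟩ : Σ i, Fin (p i - 1)) ≠ ⟨i, j⟩ := by
          rintro h'
          obtain ⟨rfl, h''⟩ := Sigma.mk.inj h'
          obtain rfl := eq_of_heq h''
          exact h rfl
        rw [if_neg h]
        simp [h']
  e_mul_x := by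
    rintro a b ⟨⟨i, j⟩, rfl, rfl⟩
    rw [← op_mul]
    congr 1
    refine LinearMap.ext fun x => ?_
    rw [Module.End.mul_apply, arrowEnd_apply, arrowEnd_apply, vertexEnd_arm]
    simp
  x_mul_e := by
    rintro a b ⟨⟨i, j⟩, rfl, rfl⟩
    rw [← op_mul]
    congr 1
    refine LinearMap.ext fun x => ?_
    rw [Module.End.mul_apply, arrowEnd_apply, map_smul]
    exact congrArg _ (vertexEnd_src_gen g i j)

theorem sum_liftData (g : Fin t → W) : ∑ v, (liftData (k := k) (p := p) g).e v = 1 := by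
  change ∑ v, op (vertexEnd k p W v) = op 1
  rw [← Finset.op_sum]
  congr 1
  refine LinearMap.ext fun x => ?_
  rw [LinearMap.sum_apply, sum_eq]
  simp only [vertexEnd_center, vertexEnd_arm]
  refine Prod.ext ?_ ?_
  · simp [Prod.fst_sum]
  · simp [Prod.snd_sum, Finset.univ_sum_single]

/-- The action of the path algebra of the star. -/
noncomputable def rep (g : Fin t → W) :
    PathAlgebra k (StarVertex p) →ₐ[k] (Module.End k (StarSpace k p W))ᵐᵒᵖ :=
  (liftData g).lift k (sum_liftData g)

end StarSpace

open StarSpace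

/-- The right module over the path algebra of a star given by a vector space `W` at the center,
lines at the other vertices, and vectors `g i` of `W`, one for each arm. -/
@[nolint unusedArguments]
def StarRep (k : Type u) [Field k] {t : ℕ} (p : Fin t → ℕ) {W : Type u} [AddCommGroup W]
    [Module k W] (_ : Fin t → W) : Type u := StarSpace k p W

namespace StarRep

instance (g : Fin t → W) : AddCommGroup (StarRep k p g) :=
  inferInstanceAs (AddCommGroup (StarSpace k p W))

instance (g : Fin t → W) : Module k (StarRep k p g) :=
  inferInstanceAs (Module k (StarSpace k p W))

variable (k p) in
/-- The elements of the star module as pairs. -/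
def ofProd (g : Fin t → W) : StarSpace k p W ≃ₗ[k] StarRep k p g :=
  LinearEquiv.refl k (StarSpace k p W)

variable (k p) in
/-- The action of the opposite of the path algebra. -/
noncomputable def action (g : Fin t → W) :
    (PathAlgebra k (StarVertex p))ᵐᵒᵖ →ₐ[k] Module.End k (StarRep k p g) :=
  (ofProd k p g).conjAlgEquiv k |>.toAlgHom.comp (AlgHom.opComm (rep g))

noncomputable instance (g : Fin t → W) :
    Module (PathAlgebra k (StarVertex p))ᵐᵒᵖ (StarRep k p g) :=
  Module.compHom _ (action k p g).toRingHom

variable {g : Fin t → W}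

theorem smul_ofProd (b : PathAlgebra k (StarVertex p)) (x : StarSpace k p W) :
    op b • ofProd k p g x = ofProd k p g ((rep g b).unop x) := rfl

theorem idem_smul (v : StarVertex p) (x : StarSpace k p W) :
    op (idem k v) • ofProd k p g x = ofProd k p g (vertexEnd k p W v x) := by
  rw [smul_ofProd, rep, LiftData.lift_idem]
  rfl

theorem ofArrow_smul (i : Fin t) (j : Fin (p i - 1)) (x : StarSpace k p W) :
    op (ofArrow k (arrow i j)) • ofProd k p g x = x.2 ⟨i, j⟩ • ofProd k p g (gen p g i j) := by
  rw [smul_ofProd, rep, LiftData.lift_ofArrow]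
  rfl

instance : IsScalarTower k (PathAlgebra k (StarVertex p))ᵐᵒᵖ (StarRep k p g) :=
  ⟨fun c b x => LinearMap.congr_fun (map_smul (action k p g) c b) x⟩

theorem ofArrow_smul_gen (i : Fin t) (j : Fin (p i - 1)) :
    op (ofArrow k (arrow i j)) • ofProd k p g (gen p g i (j + 1)) =
      ofProd k p g (gen p g i j) := by
  rw [ofArrow_smul, gen_succ]
  simp

theorem idem_smul_gen (i : Fin t) (j : Fin (p i - 1)) :
    op (idem k (arm i j)) • ofProd k p g (gen p g i (j + 1)) =
      ofProd k p g (gen p g i (j + 1)) := by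
  rw [idem_smul, gen_succ, vertexEnd_arm]
  simp

theorem dimVector_eq (v : StarVertex p) :
    dimVector k (StarRep k p g) v =
      Module.finrank k (LinearMap.range (vertexEnd k p W v)) := by
  have h : Algebra.lsmul k k (StarRep k p g) (op (idem k v)) =
      (ofProd k p g).toLinearMap ∘ₗ vertexEnd k p W v ∘ₗ (ofProd k p g).symm.toLinearMap :=
    LinearMap.ext fun x => idem_smul (g := g) v ((ofProd k p g).symm x)
  rw [dimVector, h, LinearMap.range_comp, LinearMap.range_comp_of_range_eq_top _
    (LinearEquiv.range _), LinearEquiv.finrank_map_eq]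

theorem dimVector_center :
    dimVector k (StarRep k p g) (center : StarVertex p) = Module.finrank k W := by
  rw [dimVector_eq]
  rw [vertexEnd_center_eq, LinearMap.range_comp_of_range_eq_top _
    (LinearMap.range_eq_top.2 LinearMap.fst_surjective),
    LinearMap.finrank_range_of_inj LinearMap.inl_injective]

theorem dimVector_arm (i : Fin t) (j : Fin (p i - 1)) :
    dimVector k (StarRep k p g) (arm i j) = 1 := by
  rw [dimVector_eq]
  rw [vertexEnd_arm_eq, ← LinearMap.comp_assoc, LinearMap.range_comp_of_range_eq_top,
    LinearMap.finrank_range_of_inj]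
  · simp
  · exact LinearMap.inr_injective.comp (Pi.single_injective (M := fun _ => k) _)
  · rw [LinearMap.range_comp_of_range_eq_top _
      (LinearMap.range_eq_top.2 LinearMap.snd_surjective)]
    exact LinearMap.range_eq_top.2 (Function.surjective_eval _)

section Hom

variable {N : Type v} [AddCommGroup N] [Module k N]

variable (p) in
/-- The linear map on a star module that is given by its values on the space at the center and on
the standard vectors at the other vertices. -/
def homLinear (g : Fin t → W) (h : W →ₗ[k] N) (n : Fin t → ℕ → N) : StarRep k p g →ₗ[k] N :=
  (h.coprod (Fintype.linearCombination k fun a : Σ i, Fin (p i - 1) => n a.1 (a.2 + 1))) ∘ₗ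
    (ofProd k p g).symm.toLinearMap

theorem homLinear_ofProd (h : W →ₗ[k] N) (n : Fin t → ℕ → N) (x : StarSpace k p W) :
    homLinear p g h n (ofProd k p g x) =
      h x.1 + ∑ a : Σ i, Fin (p i - 1), x.2 a • n a.1 (a.2 + 1) := rfl

theorem homLinear_single (h : W →ₗ[k] N) (n : Fin t → ℕ → N) (i : Fin t) (j : Fin (p i - 1))
    (c : k) : homLinear p g h n (ofProd k p g (0, Pi.single ⟨i, j⟩ c)) = c • n i (j + 1) := by
  rw [homLinear_ofProd, Finset.sum_eq_single ⟨i, j⟩]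
  · simp
  · intro b _ hb
    simp [hb]
  · simp

theorem homLinear_gen (h : W →ₗ[k] N) (n : Fin t → ℕ → N) (hn : ∀ i, h (g i) = n i 0)
    (i : Fin t) (j : Fin (p i - 1)) :
    homLinear p g h n (ofProd k p g (gen p g i j)) = n i j := by
  obtain ⟨_ | j, hj⟩ := j
  · simp [homLinear_ofProd, gen, hn]
  · rw [show gen (k := k) p g i (j + 1) = _ from gen_succ g i ⟨j, by omega⟩, homLinear_single]
    simp

/-- The action on `N` is an anti-multiplicative map `ρ` that need not preserve the unit. This covers
both genuine right modules and the canonical algebra, on which the star algebra acts through an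
embedding whose unit is not `1`. It is enough to check generators, where the conditions say that the
chosen values lie at the right vertices and are moved correctly by the arrows. -/
theorem homLinear_smul (ρ : PathAlgebra k (StarVertex p) →ₗ[k] Module.End k N)
    (hρ : ∀ a b, ρ (a * b) = ρ b * ρ a) (h : W →ₗ[k] N) (n : Fin t → ℕ → N)
    (hn : ∀ i, h (g i) = n i 0) (hh : ∀ w, ρ (idem k center) (h w) = h w)
    (hne : ∀ (i : Fin t) (j : Fin (p i - 1)), ρ (idem k (arm i j)) (n i (j + 1)) = n i (j + 1))
    (hnx : ∀ (i : Fin t) (j : Fin (p i - 1)), ρ (ofArrow k (arrow i j)) (n i (j + 1)) = n i j)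
    (b : PathAlgebra k (StarVertex p)) (x : StarRep k p g) :
    homLinear p g h n (op b • x) = ρ b (homLinear p g h n x) := by
  have hidem (v v' : StarVertex p) (hv : v ≠ v') (y : N) (hy : ρ (idem k v) y = y) :
      ρ (idem k v') y = 0 := by
    rw [← hy, ← Module.End.mul_apply, ← hρ, idem_mul_idem, if_neg hv]
    simp
  have harm (i : Fin t) (j : Fin (p i - 1)) (x : StarSpace k p W) :
      ρ (idem k (arm i j)) (homLinear p g h n (ofProd k p g x)) =
        x.2 ⟨i, j⟩ • n i (j + 1) := by
    rw [homLinear_ofProd, map_add, map_sum, hidem center _ (by simp) _ (hh _), zero_add,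
      Finset.sum_eq_single ⟨i, j⟩]
    · rw [map_smul, hne]
    · rintro ⟨i', j'⟩ _ hb
      rw [map_smul, hidem (arm i' j') _ _ _ (hne _ _), smul_zero]
      rintro h'
      obtain ⟨rfl, h''⟩ := arm.inj h'
      obtain rfl := eq_of_heq h''
      exact hb rfl
    · simp
  refine generator_induction (motive := fun b => ∀ x, homLinear p g h n (op b • x) =
    ρ b (homLinear p g h n x)) b ?_ ?_ ?_ ?_ ?_ ?_ x
  · simp
  · intro b b' h₁ h₂ x
    simp [add_smul, h₁, h₂]
  · intro c b h₁ x
    simp [h₁]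
  · intro b b' h₁ h₂ x
    rw [op_mul, mul_smul, h₂, h₁, hρ, Module.End.mul_apply]
  · rintro (_ | ⟨i, j⟩) x
    · obtain ⟨x, rfl⟩ := (ofProd k p g).surjective x
      rw [idem_smul, vertexEnd_center, homLinear_ofProd, homLinear_ofProd, map_add, hh, map_sum]
      simp only [map_smul, hidem (arm _ _) center (by simp) _ (hne _ _)]
      simp
    · obtain ⟨x, rfl⟩ := (ofProd k p g).surjective x
      rw [idem_smul, vertexEnd_arm, homLinear_single, harm]
  · rintro a b ⟨⟨i, j⟩, rfl, rfl⟩ x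
    obtain ⟨x, rfl⟩ := (ofProd k p g).surjective x
    change homLinear p g h n (op (ofArrow k (arrow i j)) • _) = ρ (ofArrow k (arrow i j)) _
    -- An arrow equals the idempotent of its target times itself, and `ρ` reverses products, so only
    -- the coordinate at the target contributes.
    rw [ofArrow_smul, map_smul, homLinear_gen h n hn, ← idem_mul_ofArrow, hρ,
      Module.End.mul_apply, harm, map_smul, hnx]

/-- The homomorphism from a star module to a right module over the path algebra of the star that
is given by its values on the space at the center and on the standard vectors. -/
def hom [Module (PathAlgebra k (StarVertex p))ᵐᵒᵖ N]
    [IsScalarTower k (PathAlgebra k (StarVertex p))ᵐᵒᵖ N] (h : W →ₗ[k] N) (n : Fin t → ℕ → N)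
    (hn : ∀ i, h (g i) = n i 0) (hh : ∀ w, op (idem k (center : StarVertex p)) • h w = h w)
    (hne : ∀ (i : Fin t) (j : Fin (p i - 1)), op (idem k (arm i j)) • n i (j + 1) = n i (j + 1))
    (hnx : ∀ (i : Fin t) (j : Fin (p i - 1)), op (ofArrow k (arrow i j)) • n i (j + 1) = n i j) :
    StarRep k p g →ₗ[(PathAlgebra k (StarVertex p))ᵐᵒᵖ] N :=
  { homLinear p g h n with
    map_smul' := fun b x => homLinear_smul
      ((Algebra.lsmul k k N).toLinearMap ∘ₗ (opLinearEquiv k).toLinearMap)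
      (fun a b => by simp) h n hn hh hne hnx b.unop x }

theorem hom_apply [Module (PathAlgebra k (StarVertex p))ᵐᵒᵖ N]
    [IsScalarTower k (PathAlgebra k (StarVertex p))ᵐᵒᵖ N] (h : W →ₗ[k] N) (n : Fin t → ℕ → N)
    (hn : ∀ i, h (g i) = n i 0) (hh : ∀ w, op (idem k (center : StarVertex p)) • h w = h w)
    (hne : ∀ (i : Fin t) (j : Fin (p i - 1)), op (idem k (arm i j)) • n i (j + 1) = n i (j + 1))
    (hnx : ∀ (i : Fin t) (j : Fin (p i - 1)), op (ofArrow k (arrow i j)) • n i (j + 1) = n i j)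
    (x : StarRep k p g) : hom h n hn hh hne hnx x = homLinear p g h n x := rfl

end Hom

end StarRep

end StarRep

open StarSpace

namespace StarVertex

variable {t : ℕ} {p : Fin t → ℕ}

theorem src_zero (i : Fin t) (h : 0 < p i - 1) : src p i ⟨0, h⟩ = center := rfl

theorem src_succ (i : Fin t) (j : ℕ) (h : j + 1 < p i - 1) :
    src p i ⟨j + 1, h⟩ = arm i ⟨j, Nat.lt_of_succ_lt h⟩ := by
  simp [src]

end StarVertex

/-! ### Projectivity and exceptionality of star modules -/

namespace StarRep

variable {k : Type u} [Field k] {t : ℕ} {p : Fin t → ℕ}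

theorem idem_src_smul_ofArrow_smul {N : Type v} [AddCommGroup N]
    [Module (PathAlgebra k (StarVertex p))ᵐᵒᵖ N] (i : Fin t) (j : Fin (p i - 1)) (y : N) :
    op (idem k (src p i j)) • op (ofArrow k (arrow i j)) • y =
      op (ofArrow k (arrow i j)) • y := by
  rw [← mul_smul, ← op_mul, ofArrow_mul_idem]

-- With a basis at the center this module is the direct sum of the `e_v B` for the last vertices `v`
-- of the arms. Accordingly a surjection is split by lifting one vector for each arm; the rest is
-- forced by the arrows.
variable (k p) in
theorem projective_standard (hp : ∀ i, 2 ≤ p i) :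
    Module.Projective (PathAlgebra k (StarVertex p))ᵐᵒᵖ
      (StarRep k p fun i => (Pi.single i 1 : Fin t → k)) := by
  set g : Fin t → Fin t → k := fun i => Pi.single i 1 with hg
  refine .of_lifting_property'' fun f hf => ?_
  choose a ha using fun i => hf (ofProd k p g (gen p g i (p i - 1)))
  have htop (i) : p i - 2 < p i - 1 := by have := hp i; omega
  -- The lift at the last vertex is first projected to that vertex. The branch returning `y` is a
  -- default outside the arm and is never used.
  choose s hs hss using fun i => exists_backward_sequence
    (fun j y => if h : j < p i - 1 then op (ofArrow k (arrow i ⟨j, h⟩)) • y else y) (p i - 1)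
    (op (idem k (arm i ⟨p i - 2, htop i⟩)) • a i)
  have hnx (i : Fin t) (j : Fin (p i - 1)) :
      op (ofArrow k (arrow i j)) • s i (j + 1) = s i j := by
    rw [hss i j j.2, dif_pos j.2]
  -- Before the end of the arm the vector is the image of an arrow starting at this vertex; at the
  -- end the idempotent was built in.
  have hne (i : Fin t) (j : Fin (p i - 1)) :
      op (idem k (arm i j)) • s i (j + 1) = s i (j + 1) := by
    obtain ⟨j, hj⟩ := j
    by_cases h : j + 1 < p i - 1
    · have := idem_src_smul_ofArrow_smul (k := k) i ⟨j + 1, h⟩ (s i (j + 1 + 1))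
      rw [hnx i ⟨j + 1, h⟩] at this
      rwa [src_succ] at this
    · obtain rfl : j = p i - 2 := by omega
      have h1 : p i - 2 + 1 = p i - 1 := by have := hp i; omega
      change op (idem k (arm i ⟨p i - 2, htop i⟩)) • s i (p i - 2 + 1) = s i (p i - 2 + 1)
      rw [h1, hs, ← mul_smul, ← op_mul, idem_mul_idem, if_pos rfl]
  -- Induction on the distance `d` from the end of the arm.
  have hfs (i : Fin t) (d : ℕ) : ∀ j, j + d = p i - 1 →
      f (s i j) = ofProd k p g (gen p g i j) := by
    induction d with
    | zero =>
      rintro j rfl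
      have h1 : p i - 2 + 1 = p i - 1 := by have := hp i; omega
      have h2 : _ • ofProd k p g (gen p g i (p i - 2 + 1)) =
          ofProd k p g (gen p g i (p i - 2 + 1)) :=
        idem_smul_gen i ⟨p i - 2, htop i⟩
      rw [h1] at h2
      rw [hs, map_smul, ha, h2]
    | succ d ih =>
      intro j hj
      have hj' : j < p i - 1 := by omega
      rw [← hnx i ⟨j, hj'⟩, map_smul]
      change _ • f (s i (j + 1)) = _
      rw [ih (j + 1) (by omega)]
      exact ofArrow_smul_gen i ⟨j, hj'⟩
  have hpos (i) : 0 < p i - 1 := by have := hp i; omega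
  have hn (i) : Fintype.linearCombination k (fun i => s i 0) (g i) = s i 0 := by
    rw [Fintype.linearCombination_apply, Finset.sum_eq_single i]
    · simp [hg]
    · intro b _ hb
      simp [hg, hb]
    · simp
  have hc (i) : op (idem k (center : StarVertex p)) • s i 0 = s i 0 := by
    have := idem_src_smul_ofArrow_smul (k := k) i ⟨0, hpos i⟩ (s i (0 + 1))
    rw [hnx i ⟨0, hpos i⟩] at this
    rwa [src_zero] at this
  refine ⟨hom (g := g) (Fintype.linearCombination k fun i => s i 0) s hn ?_ hne hnx,
    LinearMap.ext fun x => ?_⟩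
  · intro w
    simp only [Fintype.linearCombination_apply, Finset.smul_sum]
    refine Finset.sum_congr rfl fun i _ => ?_
    rw [smul_comm, hc]
  · obtain ⟨x, rfl⟩ := (ofProd k p g).surjective x
    change f (homLinear p g _ s (ofProd k p g x)) = ofProd k p g x
    let f' := f.restrictScalars k
    change f' _ = _
    rw [homLinear_ofProd, Fintype.linearCombination_apply, map_add, map_sum, map_sum]
    simp only [map_smul]
    have h1 (i) : f' (s i 0) = ofProd k p g (gen p g i 0) := hfs i _ _ (zero_add _)
    have h2 (b : Σ i, Fin (p i - 1)) :
        f' (s b.1 (b.2 + 1)) = ofProd k p g (gen p g b.1 (b.2 + 1)) :=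
      hfs b.1 (p b.1 - 1 - (b.2 + 1)) _ (by have := b.2.2; omega)
    simp only [h1, h2, gen_succ]
    simp only [← map_smul, ← map_sum, ← map_add]
    congr 1
    refine Prod.ext ?_ ?_
    · simp only [gen, hg, Prod.fst_add, Prod.fst_sum, Prod.smul_fst, smul_zero,
        Finset.sum_const_zero, add_zero]
      ext i
      simp [Finset.sum_apply, Pi.single_apply]
    · simp only [gen, Prod.snd_add, Prod.snd_sum, Prod.smul_snd, smul_zero,
        Finset.sum_const_zero, zero_add]
      ext b
      simp [Finset.sum_apply, Pi.single_apply]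

section Map

variable {W W' : Type u} [AddCommGroup W] [Module k W] [AddCommGroup W'] [Module k W']
  {g : Fin t → W} {g' : Fin t → W'}

/-- The homomorphism between star modules given by a linear map at the center and by scalars at
the arms. -/
noncomputable def map (h : W →ₗ[k] W') (c : Fin t → k) (hc : ∀ i, h (g i) = c i • g' i) :
    StarRep k p g →ₗ[(PathAlgebra k (StarVertex p))ᵐᵒᵖ] StarRep k p g' :=
  hom ((ofProd k p g').toLinearMap ∘ₗ LinearMap.inl k W' _ ∘ₗ h)
    (fun i j => c i • ofProd k p g' (gen p g' i j))
    (fun i => by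
      rw [← map_smul]
      have h1 : ((h (g i), 0) : StarSpace k p W') = c i • (g' i, 0) := by rw [hc]; simp
      exact congrArg (ofProd k p g') h1)
    (fun w => by
      rw [LinearMap.comp_apply, LinearMap.comp_apply]
      exact idem_smul center (h w, 0))
    (fun i j => by rw [smul_comm, idem_smul_gen])
    (fun i j => by rw [smul_comm, ofArrow_smul_gen])

theorem map_ofProd (h : W →ₗ[k] W') (c : Fin t → k) (hc : ∀ i, h (g i) = c i • g' i)
    (x : StarSpace k p W) : map h c hc (ofProd k p g x) =
      ofProd k p g' (h x.1, fun a => c a.1 * x.2 a) := by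
  rw [map, hom_apply, homLinear_ofProd]
  simp only [gen_succ, ← map_smul, ← map_sum]
  refine (map_add (ofProd k p g') (h x.1, 0) _).symm.trans (congrArg _ ?_)
  refine Prod.ext ?_ ?_
  · simp [Prod.fst_sum]
  · ext a
    simp [Prod.snd_sum, Finset.sum_apply, Pi.single_apply, mul_comm]

end Map

/-- No arrow ends at the center, so only the trivial path does; thus `e_c B` is one-dimensional. -/
theorem exists_idem_center_mul (x : PathAlgebra k (StarVertex p)) :
    ∃ c : k, idem k center * x = c • idem k center := by
  refine induction_on x ⟨0, by simp⟩ ?_ ?_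
  · rintro x y ⟨c, hc⟩ ⟨d, hd⟩
    exact ⟨c + d, by rw [mul_add, hc, hd, add_smul]⟩
  · intro c a b q
    by_cases hb : center = b
    · subst hb
      refine ⟨c, ?_⟩
      rw [mul_smul_comm, idem_mul_ofPath]
      cases q with
      | nil => rfl
      | cons q y => exact ((isEmpty_hom_center _).false y).elim
    · refine ⟨0, ?_⟩
      rw [mul_smul_comm, idem, ofPath_mul_ofPath_of_ne _ _ hb]
      simp

/-- The vectors `(1, 0)`, `(0, 1)`, `(1, -l)` in the plane. -/
def planeVector (l : k) : Fin 3 → k × k := ![(1, 0), (0, 1), (1, -l)]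

variable {p : Fin 3 → ℕ}

/-- The structure maps along an arm are isomorphisms of lines, so an endomorphism acts on a whole
arm by one scalar, which is also its eigenvalue on `g i` at the center. Three pairwise independent
eigenvectors in a plane force equal eigenvalues. -/
theorem end_planeVector {l : k} (hl : l ≠ 0) (hp : ∀ i, 2 ≤ p i) :
    ∀ φ : Module.End (PathAlgebra k (StarVertex p))ᵐᵒᵖ (StarRep k p (planeVector l)),
      ∃ c : k, ∀ x, φ x = c • x := by
  set g := planeVector l
  intro φ
  let F : StarSpace k p (k × k) →ₗ[k] StarSpace k p (k × k) :=
    (ofProd k p g).symm.toLinearMap ∘ₗ φ.restrictScalars k ∘ₗ (ofProd k p g).toLinearMap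
  have hF (x) : φ (ofProd k p g x) = ofProd k p g (F x) := rfl
  have hv (v : StarVertex p) (x) : F (vertexEnd k p _ v x) = vertexEnd k p _ v (F x) := by
    apply (ofProd k p g).injective
    rw [← hF, ← idem_smul, map_smul, hF, idem_smul]
  -- The scalar of the arm is read off at its first vertex.
  have hgen (i : Fin 3) (d : ℕ) (hd : d < p i - 1) : F (gen p g i (d + 1)) =
      (F (gen p g i (0 + 1))).2 ⟨i, 0, by have := hp i; omega⟩ • gen p g i (d + 1) ∧
      F (gen p g i 0) =
      (F (gen p g i (0 + 1))).2 ⟨i, 0, by have := hp i; omega⟩ • gen p g i 0 := by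
    have harr (j : Fin (p i - 1)) : F (gen p g i j) =
        (F (gen p g i (j + 1))).2 ⟨i, j⟩ • gen p g i j := by
      apply (ofProd k p g).injective
      rw [← hF, ← ofArrow_smul_gen, map_smul, hF, ofArrow_smul, map_smul]
    have harm (j : Fin (p i - 1)) : F (gen p g i (j + 1)) =
        (F (gen p g i (j + 1))).2 ⟨i, j⟩ • gen p g i (j + 1) := by
      have h1 : gen p g i (j + 1) = vertexEnd k p _ (arm i j) (gen p g i (j + 1)) := by
        rw [gen_succ, vertexEnd_arm]
        simp
      conv_lhs => rw [h1, hv]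
      rw [vertexEnd_arm, gen_succ]
      refine Prod.ext (by simp) ?_
      ext a
      simp [Pi.single_apply]
    refine ⟨?_, harr ⟨0, _⟩⟩
    induction d with
    | zero => exact harm ⟨0, hd⟩
    | succ d ih =>
      have ih := ih (by omega)
      have h1 := harr ⟨d + 1, hd⟩
      change F (gen p g i (d + 1)) = _ • gen p g i (d + 1) at h1
      have h2 : gen (k := k) p g i (d + 1) ≠ 0 := by
        rw [show gen (k := k) p g i (d + 1) = _ from gen_succ g i ⟨d, by omega⟩]
        intro h
        have := congrFun (congrArg Prod.snd h) ⟨i, ⟨d, by omega⟩⟩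
        simp at this
      -- The same nonzero vector is scaled by the old scalar and, through the next arrow, by the
      -- scalar at the next vertex; so the two agree.
      have h3 := smul_left_injective k h2 (ih.symm.trans h1)
      rw [h3]
      exact harm ⟨d + 1, hd⟩
  have hpos (i) : 0 < p i - 1 := by have := hp i; omega
  obtain ⟨c, hc⟩ : ∃ c : Fin 3 → k, ∀ (i : Fin 3) (d : ℕ), d ≤ p i - 1 →
      F (gen p g i d) = c i • gen p g i d := by
    refine ⟨fun i => (F (gen p g i (0 + 1))).2 ⟨i, 0, hpos i⟩, fun i d hd => ?_⟩
    rcases d with _ | d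
    · exact (hgen i 0 (hpos i)).2
    · exact (hgen i d hd).1
  let h : k × k →ₗ[k] k × k := LinearMap.fst k _ _ ∘ₗ F ∘ₗ LinearMap.inl k _ _
  have hh (i) : h (g i) = c i • g i := congrArg Prod.fst (hc i 0 (Nat.zero_le _))
  have h0 : h (1, 0) = c 0 • (1, 0) := hh 0
  have h1 : h (0, 1) = c 1 • (0, 1) := hh 1
  have h2 : h (1, -l) = c 2 • (1, -l) := hh 2
  -- Expanding the third eigenvector in the first two and comparing coefficients gives `c 2 = c 0`
  -- and, after cancelling `-l`, `c 2 = c 1`.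
  have h3 : ((1, -l) : k × k) = (1, 0) + (-l) • (0, 1) := by simp
  have h4 : h (1, -l) = c 0 • (1, 0) + (-l) • c 1 • (0, 1) := by
    rw [h3, map_add, map_smul, h0, h1]
  rw [h2] at h4
  have e0 : c 2 = c 0 := by simpa using congrArg Prod.fst h4
  have e1 : c 2 = c 1 := by
    have := congrArg Prod.snd h4
    simp only [Prod.smul_mk, smul_eq_mul, Prod.snd_add, mul_zero, mul_one, zero_add] at this
    exact mul_right_cancel₀ (neg_ne_zero.2 hl) (by rw [this, mul_comm])
  have hcc (i) : c i = c 2 := by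
    fin_cases i
    · exact e0.symm
    · exact e1.symm
    · rfl
  refine ⟨c 2, fun x => ?_⟩
  obtain ⟨⟨⟨a, b⟩, f⟩, rfl⟩ := (ofProd k p g).surjective x
  rw [hF, ← map_smul]
  congr 1
  have hx : (((a, b), f) : StarSpace k p (k × k)) = a • gen p g 0 0 + b • gen p g 1 0 +
      ∑ y : Σ i, Fin (p i - 1), f y • gen p g y.1 (y.2 + 1) := by
    simp only [gen_succ]
    refine Prod.ext ?_ ?_
    · simp [gen, g, planeVector, Prod.fst_sum]
    · ext y
      simp [gen, Prod.snd_sum, Finset.sum_apply, Pi.single_apply]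
  rw [hx, map_add, map_add, map_sum, smul_add, smul_add, Finset.smul_sum]
  simp only [map_smul]
  rw [hc 0 0 (Nat.zero_le _), hc 1 0 (Nat.zero_le _), hcc 0, hcc 1, smul_comm a, smul_comm b]
  congr 1
  refine Finset.sum_congr rfl fun y _ => ?_
  rw [hc _ _ y.2.2, hcc, smul_comm]

/-- The action on an element of a right module, restricted to a right ideal. -/
def orbitMap {B : Type u} [Ring B] {N : Type v} [AddCommGroup N] [Module Bᵐᵒᵖ N] (e : B) (m : N) :
    idemModule e →ₗ[Bᵐᵒᵖ] N where
  toFun y := op (y : B) • m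
  map_add' y z := by simp [add_smul]
  map_smul' b y := by
    change op ((y : B) * b.unop) • m = b • op (y : B) • m
    rw [op_mul, mul_smul, op_unop]

/-- The resolution is `0 → e_c B → P → M → 0`, where `P` has `k^3` at the center and `P → M` sends
the standard basis to the three plane vectors. -/
theorem isExceptionalModule_planeVector {l : k} (hl : l ≠ 0) (hp : ∀ i, 2 ≤ p i) :
    IsExceptionalModule k (PathAlgebra k (StarVertex p)) (StarRep k p (planeVector l)) where
  finite := inferInstanceAs (Module.Finite k (StarSpace k p (k × k)))
  end_eq := by
    constructor
    · intro c d h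
      have h1 := congrArg (ofProd k p (planeVector l)).symm
        (LinearMap.congr_fun h (ofProd k p _ ((1, 0), 0)))
      have h2 : (c • ((1, 0), 0) : StarSpace k p (k × k)) = d • ((1, 0), 0) := h1
      simpa using congrArg (fun x => x.1.1) h2
    · intro φ
      obtain ⟨c, hc⟩ := end_planeVector hl hp φ
      exact ⟨c, LinearMap.ext fun x => (hc x).symm⟩
  ext_eq_zero := by
    set g := planeVector l
    let g₀ : Fin 3 → Fin 3 → k := fun i => Pi.single i 1
    let e : PathAlgebra k (StarVertex p) := idem k center
    have he : e * e = e := (idem_mul_idem _ _).trans (if_pos rfl)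
    -- The coefficients of the linear relation `g 0 - l • g 1 - g 2 = 0`, which span the kernel of
    -- `π`.
    let r : StarRep k p g₀ := ofProd k p g₀ (![1, -l, -1], 0)
    have hsum (c : Fin 3 → k) (i) :
        Fintype.linearCombination k (fun j => c j • g j) (g₀ i) = c i • g i := by
      rw [Fintype.linearCombination_apply, Finset.sum_eq_single i]
      · simp [g₀]
      · intro b _ hb
        simp [g₀, hb]
      · simp
    let π : StarRep k p g₀ →ₗ[(PathAlgebra k (StarVertex p))ᵐᵒᵖ] StarRep k p g :=
      map _ (fun _ => 1) (hsum fun _ => 1)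
    have hy (y : idemModule e) : ∃ c : k, (y : PathAlgebra k (StarVertex p)) = c • e := by
      obtain ⟨c, hc⟩ := exists_idem_center_mul (y : PathAlgebra k (StarVertex p))
      exact ⟨c, y.2.symm.trans hc⟩
    have her : op e • r = r := idem_smul _ _
    have hr0 : r ≠ 0 := by
      intro h
      have h1 : ((![1, -l, -1], 0) : StarSpace k p (Fin 3 → k)) = 0 :=
        (ofProd k p g₀).map_eq_zero_iff.1 h
      simpa using congrFun (congrArg Prod.fst h1) 0
    have hπ (x : StarSpace k p (Fin 3 → k)) : π (ofProd k p g₀ x) =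
        ofProd k p g ((x.1 0 + x.1 2, x.1 1 - l * x.1 2), x.2) := by
      rw [map_ofProd]
      congr 1
      refine Prod.ext ?_ (by ext; simp)
      simp [Fintype.linearCombination_apply, Fin.sum_univ_three, g, planeVector]
      ring
    have hP := projective_standard k p hp
    have hQ := idemModule_projective he
    intro n hn
    refine ModuleCat.ext_subsingleton_of_resolution (orbitMap e r) π ?_ ?_ ?_ ?_ n hn
    · rw [injective_iff_map_eq_zero]
      intro y h
      obtain ⟨c, hc⟩ := hy y
      change op (y : PathAlgebra k (StarVertex p)) • r = 0 at h
      rw [hc, op_smul, smul_assoc, her, smul_eq_zero_iff_left hr0] at h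
      apply Subtype.ext
      rw [hc, h, zero_smul]
      rfl
    · intro x
      constructor
      · intro h
        obtain ⟨⟨w, f⟩, rfl⟩ := (ofProd k p g₀).surjective x
        rw [hπ, LinearEquiv.map_eq_zero_iff, Prod.mk_eq_zero, Prod.mk_eq_zero] at h
        obtain ⟨⟨h1, h2⟩, h3 : f = 0⟩ := h
        refine ⟨⟨w 0 • e, by rw [mem_idemModule, mul_smul_comm, he]⟩, ?_⟩
        change op (w 0 • e) • r = _
        rw [op_smul, smul_assoc, her, ← map_smul]
        congr 1
        refine Prod.ext ?_ (by simp [h3])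
        ext i
        fin_cases i
        · simp
        · simp only [sub_eq_zero] at h2
          simp only [add_eq_zero_iff_eq_neg] at h1
          simp [h1, h2, mul_comm]
        · simp only [add_eq_zero_iff_eq_neg] at h1
          simp [h1]
      · rintro ⟨y, rfl⟩
        change π (op (y : PathAlgebra k (StarVertex p)) • r) = 0
        rw [map_smul, hπ]
        simp
        exact (congrArg _ (map_zero (ofProd k p g))).trans (smul_zero _)
    · intro x
      obtain ⟨⟨⟨a, b⟩, f⟩, rfl⟩ := (ofProd k p g).surjective x
      refine ⟨ofProd k p g₀ (![a, b, 0], f), ?_⟩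
      rw [hπ]
      simp
    · intro h
      let e' : idemModule e := ⟨e, he⟩
      have hee : op e • e' = e' := Subtype.ext he
      obtain ⟨⟨⟨a, b⟩, f⟩, hab⟩ := (ofProd k p g).surjective (h e')
      have hm : h e' = ofProd k p g ((a, b), 0) := by
        rw [← hee, map_smul, ← hab]
        exact idem_smul _ _
      -- Scaling the arms by `c` sends `r` to `c 0 • g 0 - (l * c 1) • g 1 - c 2 • g 2`. These
      -- scalars make this equal to `(a, b)`, the prescribed image of the generator.
      refine ⟨map _ _ (hsum ![a, -l⁻¹ * b, 0]), LinearMap.ext fun y => ?_⟩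
      have hye : y = op (y : PathAlgebra k (StarVertex p)) • e' := Subtype.ext y.2.symm
      have hr : map _ _ (hsum ![a, -l⁻¹ * b, 0]) r = h e' := by
        rw [map_ofProd, hm]
        congr 1
        refine Prod.ext ?_ (by ext; simp)
        simp [Fintype.linearCombination_apply, Fin.sum_univ_three, g, planeVector, hl]
      change map _ _ (hsum ![a, -l⁻¹ * b, 0]) (op (y : PathAlgebra k (StarVertex p)) • r) = h y
      rw [map_smul, hr, ← map_smul, ← hye]

end StarRep

end StarRepresentations

/-! ### The canonical algebra as a one-point extension of the star -/

section CanonicalExtension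

open MulOpposite

namespace CanonicalVertex

open PathAlgebra

variable {t : ℕ} {p : Fin t → ℕ}

theorem src_succ (i : Fin t) (j : Fin (p i - 1)) (h : j.val + 1 < p i) :
    src p i ⟨j + 1, h⟩ = arm i j := by
  simp [src]

theorem tgt_of_lt (i : Fin t) (j : Fin (p i)) (h : j.val < p i - 1) :
    tgt p i j = arm i ⟨j, h⟩ := dif_pos h

theorem tgt_of_not_lt (i : Fin t) (j : Fin (p i)) (h : ¬ j.val < p i - 1) :
    tgt p i j = sink := dif_neg h

/-- The vertices of the star as vertices of the quiver of the canonical algebra. -/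
def ofStar : StarVertex p → CanonicalVertex p
  | .center => source
  | .arm i j => arm i j

theorem ofStar_injective : Function.Injective (ofStar (p := p)) := by
  rintro (_ | _) (_ | _) h <;> cases h <;> rfl

/-- The vertices of the quiver of the canonical algebra other than the sink form a star. -/
def optionEquiv : Option (StarVertex p) ≃ CanonicalVertex p where
  toFun
    | none => sink
    | some v => ofStar v
  invFun
    | source => some .center
    | arm i j => some (.arm i j)
    | sink => none
  left_inv := by rintro (_ | _ | _) <;> rfl
  right_inv := by rintro (_ | _ | _) <;> rfl

theorem sum_eq {A : Type v} [AddCommMonoid A] (f : CanonicalVertex p → A) :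
    ∑ v, f v = f sink + ∑ v, f (ofStar v) := by
  rw [← optionEquiv.sum_comp, Fintype.sum_option]
  rfl

/-- The arrow of the quiver of the canonical algebra that corresponds to an arrow of the star. -/
def castArrow (i : Fin t) (j : Fin (p i - 1)) : Fin (p i) := ⟨j, by omega⟩

theorem src_castArrow (i : Fin t) (j : Fin (p i - 1)) :
    src p i (castArrow i j) = ofStar (StarVertex.src p i j) := by
  unfold src StarVertex.src castArrow
  split_ifs <;> rfl

theorem tgt_castArrow (i : Fin t) (j : Fin (p i - 1)) :
    tgt p i (castArrow i j) = arm i j := dif_pos j.2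

end CanonicalVertex

open PathAlgebra CanonicalVertex OnePointExtension

namespace CanonicalAlgebra

variable (k : Type u) [Field k] {t : ℕ} (p : Fin t → ℕ)

/-- The images of the generators of the path algebra of the star. -/
noncomputable def starData : LiftData (StarVertex p) (PathAlgebra k (CanonicalVertex p)) where
  e v := idem k (ofStar v)
  x q := ofArrow k (arrow p q.1.1 (castArrow q.1.1 q.1.2))
  e_mul_e a b := by
    rw [idem_mul_idem]
    exact if_congr ofStar_injective.eq_iff rfl rfl
  e_mul_x := by
    rintro a b ⟨⟨i, j⟩, rfl, rfl⟩
    exact (congrArg (fun v => idem k v * ofArrow k (arrow p i (castArrow i j)))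
      (tgt_castArrow i j).symm).trans (idem_mul_ofArrow _)
  x_mul_e := by
    rintro a b ⟨⟨i, j⟩, rfl, rfl⟩
    exact (congrArg (fun v => ofArrow k (arrow p i (castArrow i j)) * idem k v)
      (src_castArrow i j).symm).trans (ofArrow_mul_idem _)

theorem starData_liftLinear_one :
    (starData k p).liftLinear k 1 + idem k sink = 1 := by
  rw [LiftData.liftLinear_one, one_def, sum_eq, add_comm]
  rfl

/-- The path along the `i`-th arm from the source of the `j`-th arrow to the sink. -/
noncomputable def armTail (i : Fin t) (j : ℕ) : PathAlgebra k (CanonicalVertex p) :=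
  ((List.ofFn fun j : Fin (p i) => ofArrow k (arrow p i j)).drop j).reverse.prod

theorem armTail_zero (i : Fin t) : armTail k p i 0 = armPath k p i := rfl

/-- The empty product is the unit of the whole algebra, not the trivial path at the sink; hence the
bound `j < p i` in `idem_sink_mul_armTail`. -/
theorem armTail_length (i : Fin t) : armTail k p i (p i) = 1 := by
  rw [armTail, List.drop_of_length_le (by simp)]
  rfl

theorem armTail_eq (i : Fin t) (j : ℕ) (h : j < p i) :
    armTail k p i j = armTail k p i (j + 1) * ofArrow k (arrow p i ⟨j, h⟩) := by
  rw [armTail, List.drop_eq_getElem_cons (by simpa using h), List.reverse_cons, List.prod_append,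
    List.prod_singleton, List.getElem_ofFn]
  rfl

theorem armTail_mul_idem_src (i : Fin t) (j : ℕ) (h : j < p i) :
    armTail k p i j * idem k (src p i ⟨j, h⟩) = armTail k p i j := by
  rw [armTail_eq k p i j h, mul_assoc, ofArrow_mul_idem]

theorem armTail_mul_idem_arm (i : Fin t) (j : Fin (p i - 1)) :
    armTail k p i (j + 1) * idem k (arm i j) = armTail k p i (j + 1) := by
  have h : j.val + 1 < p i := by omega
  have := armTail_mul_idem_src k p i (j + 1) h
  rwa [src_succ] at this

theorem idem_sink_mul_armTail (i : Fin t) (j : ℕ) (h : j < p i) :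
    idem k sink * armTail k p i j = armTail k p i j := by
  obtain ⟨d, hd⟩ := Nat.exists_eq_add_of_lt h
  induction d generalizing j with
  | zero =>
    have h1 := armTail_eq k p i j h
    have h2 : j + 1 = p i := by omega
    rw [h2, armTail_length, one_mul] at h1
    rw [h1]
    exact (congrArg (fun v => idem k v * ofArrow k (arrow p i ⟨j, h⟩))
      (tgt_of_not_lt i ⟨j, h⟩ (by change ¬ j < _; omega)).symm).trans (idem_mul_ofArrow _)
  | succ d ih =>
    rw [armTail_eq k p i j h, ← mul_assoc, ih (j + 1) (by omega) (by omega)]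

section Extension

variable {k p}

variable {W : Type u} [AddCommGroup W] [Module k W] (g : Fin t → W) (hp : ∀ i, 2 ≤ p i)

open StarRep StarSpace

include hp in
theorem lt_of_two_le (i : Fin t) : p i - 2 < p i - 1 := by
  have := hp i
  omega

/-- The images of the trivial paths in a one-point extension. -/
noncomputable def extensionIdem : CanonicalVertex p →
    OnePointExtension k (PathAlgebra k (StarVertex p)) (StarRep k p g)
  | source => mk _ _ _ (idem k .center) 0 0
  | arm i j => mk _ _ _ (idem k (.arm i j)) 0 0
  | sink => mk _ _ _ 0 0 1

theorem extensionIdem_ofStar (v : StarVertex p) :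
    extensionIdem g (ofStar v) = mk k _ _ (idem k v) 0 0 := by
  cases v <;> rfl

theorem extensionIdem_sink : extensionIdem g (sink : CanonicalVertex p) = mk k _ _ 0 0 1 := rfl

/-- The images of the arrows in a one-point extension. -/
noncomputable def extensionArrow (i : Fin t) (j : Fin (p i)) :
    OnePointExtension k (PathAlgebra k (StarVertex p)) (StarRep k p g) :=
  if h : j.val < p i - 1 then mk _ _ _ (ofArrow k (StarVertex.arrow i ⟨j, h⟩)) 0 0
  else mk _ _ _ 0 (ofProd k p g (gen p g i (p i - 1))) 0

theorem extensionIdem_mul_extensionIdem (a b : CanonicalVertex p) :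
    extensionIdem (k := k) g a * extensionIdem g b = if a = b then extensionIdem g a else 0 := by
  obtain ⟨_ | a, rfl⟩ := optionEquiv.surjective a <;>
    obtain ⟨_ | b, rfl⟩ := optionEquiv.surjective b
  · change mk _ _ _ 0 0 1 * mk _ _ _ 0 0 1 = _
    simp only [mk_mul_mk, if_true]
    change _ = mk _ _ _ 0 0 1
    simp
  · rw [if_neg (by simp)]
    change mk _ _ _ 0 0 1 * extensionIdem g (ofStar b) = _
    rw [extensionIdem_ofStar]
    simp [mk_mul_mk, zero_eq_mk]
  · rw [if_neg (by simp)]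
    change extensionIdem g (ofStar a) * mk _ _ _ 0 0 1 = _
    rw [extensionIdem_ofStar]
    simp [mk_mul_mk, zero_eq_mk]
  · change extensionIdem g (ofStar a) * extensionIdem g (ofStar b) =
      if ofStar a = ofStar b then extensionIdem g (ofStar a) else 0
    rw [extensionIdem_ofStar, extensionIdem_ofStar, mk_mul_mk, idem_mul_idem]
    by_cases hab : a = b
    · simp [hab]
    · simp [hab, ofStar_injective.eq_iff, zero_eq_mk]

theorem extensionIdem_tgt_mul (i : Fin t) (j : Fin (p i)) :
    extensionIdem (k := k) g (tgt p i j) * extensionArrow g i j = extensionArrow g i j := by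
  by_cases h : j.val < p i - 1
  · rw [extensionArrow, dif_pos h, tgt_of_lt i j h]
    change extensionIdem g (ofStar (.arm i ⟨j, h⟩)) * _ = _
    rw [extensionIdem_ofStar, mk_mul_mk, idem_mul_ofArrow]
    simp
  · rw [extensionArrow, dif_neg h, tgt_of_not_lt i j h, extensionIdem_sink]
    simp [mk_mul_mk]

include hp in
theorem extensionArrow_mul_src (i : Fin t) (j : Fin (p i)) :
    extensionArrow g i j * extensionIdem (k := k) g (src p i j) = extensionArrow g i j := by
  by_cases h : j.val < p i - 1
  · rw [extensionArrow, dif_pos h,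
      show src p i j = ofStar (StarVertex.src p i ⟨j, h⟩) from src_castArrow i ⟨j, h⟩,
      extensionIdem_ofStar, mk_mul_mk, ofArrow_mul_idem]
    simp
  · have h1 : p i - 2 + 1 = p i - 1 := by have := hp i; omega
    obtain ⟨j, hj⟩ := j
    change ¬ j < p i - 1 at h
    obtain rfl : j = p i - 2 + 1 := by omega
    have h2 : _ • ofProd k p g (gen p g i (p i - 2 + 1)) =
        ofProd k p g (gen p g i (p i - 2 + 1)) :=
      idem_smul_gen i ⟨p i - 2, lt_of_two_le hp i⟩
    rw [h1] at h2
    rw [extensionArrow, dif_neg h, src_succ i ⟨p i - 2, lt_of_two_le hp i⟩]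
    change _ * extensionIdem g (ofStar (.arm i _)) = _
    rw [extensionIdem_ofStar, mk_mul_mk, h2]
    simp

/-- The images of the generators of the path algebra in a one-point extension of the path algebra
of the star. -/
noncomputable def extensionData : LiftData (CanonicalVertex p)
    (OnePointExtension k (PathAlgebra k (StarVertex p)) (StarRep k p g)) where
  e := extensionIdem g
  x q := extensionArrow g q.1.1 q.1.2
  e_mul_e := extensionIdem_mul_extensionIdem g
  e_mul_x := by
    rintro a b ⟨⟨i, j⟩, rfl, rfl⟩
    exact extensionIdem_tgt_mul g i j
  x_mul_e := by
    rintro a b ⟨⟨i, j⟩, rfl, rfl⟩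
    exact extensionArrow_mul_src g hp i j

theorem extensionData_e_ofStar (v : StarVertex p) :
    (extensionData g hp).e (ofStar v) = mk k _ _ (idem k v) 0 0 :=
  extensionIdem_ofStar g v

theorem sum_extensionData : ∑ v, (extensionData (k := k) g hp).e v = 1 := by
  rw [sum_eq]
  simp only [extensionData_e_ofStar, ← inl_apply]
  rw [← map_sum, ← one_def, inl_apply]
  change mk _ _ _ 0 0 1 + _ = _
  rw [mk_add_mk]
  simp [one_eq_mk]

/-- The homomorphism from the path algebra to the one-point extension. -/
noncomputable def toExtension : PathAlgebra k (CanonicalVertex p) →ₐ[k]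
    OnePointExtension k (PathAlgebra k (StarVertex p)) (StarRep k p g) :=
  (extensionData g hp).lift k (sum_extensionData g hp)

theorem toExtension_idem (v : CanonicalVertex p) :
    toExtension g hp (idem k v) = (extensionData g hp).e v :=
  LiftData.lift_idem _ _ _

theorem toExtension_ofArrow (i : Fin t) (j : Fin (p i)) :
    toExtension g hp (ofArrow k (arrow p i j)) = if h : j.val < p i - 1 then
      mk _ _ _ (ofArrow k (StarVertex.arrow i ⟨j, h⟩)) 0 0 else
      mk _ _ _ 0 (ofProd k p g (gen p g i (p i - 1))) 0 :=
  LiftData.lift_ofArrow _ _ _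

theorem toExtension_starData (b : PathAlgebra k (StarVertex p)) :
    toExtension g hp ((starData k p).liftLinear k b) = mk _ _ _ b 0 0 := by
  refine generator_induction b ?_ ?_ ?_ ?_ ?_ ?_
  · simp [zero_eq_mk]
  · intro x y hx hy
    simp [hx, hy, mk_add_mk]
  · intro c x hx
    simp [hx, smul_mk]
  · intro x y hx hy
    simp [LiftData.liftLinear_mul, hx, hy, mk_mul_mk]
  · intro v
    rw [LiftData.liftLinear_idem]
    exact (toExtension_idem _ _ _).trans (extensionData_e_ofStar _ _ _)
  · rintro a b ⟨⟨i, j⟩, rfl, rfl⟩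
    rw [LiftData.liftLinear_ofArrow]
    exact (toExtension_ofArrow _ _ _ _).trans (dif_pos j.2)

/-- The last arrow gives the standard vector at the end of the arm, and each earlier arrow moves it
one step towards the center. For `j = 0` this gives `g i`, so relations between arm paths become
linear relations between the vectors `g i`. -/
theorem toExtension_armTail (i : Fin t) (j : ℕ) (h : j < p i) :
    toExtension g hp (armTail k p i j) = mk _ _ _ 0 (ofProd k p g (gen p g i j)) 0 := by
  obtain ⟨d, hd⟩ := Nat.exists_eq_add_of_lt h
  induction d generalizing j with
  | zero =>
    have h2 : j + 1 = p i := by omega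
    have h3 : p i - 1 = j := by omega
    rw [armTail_eq k p i j h, h2, armTail_length, one_mul, toExtension_ofArrow,
      dif_neg (by change ¬ j < _; omega), h3]
  | succ d ih =>
    have hj : j < p i - 1 := by omega
    rw [armTail_eq k p i j h, map_mul, ih (j + 1) (by omega) (by omega), toExtension_ofArrow,
      dif_pos hj, mk_mul_mk]
    have h1 : _ • ofProd k p g (gen p g i (j + 1)) = ofProd k p g (gen p g i j) :=
      ofArrow_smul_gen i ⟨j, hj⟩
    simp only [h1]
    simp

end Extension

/-! ### Three weights: the relation and the two inverse homomorphisms -/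

section ThreeWeights

open StarRep StarSpace

variable {k : Type u} [Field k] {p : Fin 3 → ℕ} (hp : ∀ i, 2 ≤ p i) (lam : Fin 1 → k)

theorem toExtension_armPath (i : Fin 3) : toExtension (planeVector (lam 0)) hp (armPath k p i) =
    mk _ _ _ 0 (ofProd k p _ (planeVector (lam 0) i, 0)) 0 :=
  toExtension_armTail _ hp i 0 (by have := hp i; omega)

/-- The homomorphism from the canonical algebra to the one-point extension. -/
noncomputable def toStarExtension : CanonicalAlgebra k p lam →ₐ[k]
    OnePointExtension k (PathAlgebra k (StarVertex p)) (StarRep k p (planeVector (lam 0))) :=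
  RingQuot.liftAlgHom k ⟨toExtension (planeVector (lam 0)) hp, by
    rintro _ _ ⟨j⟩
    obtain rfl := Subsingleton.elim j 0
    -- In the plane the relation reads `(1, -λ) = (1, 0) - λ (0, 1)`.
    rw [map_sub, map_smul, toExtension_armPath, toExtension_armPath, toExtension_armPath, smul_mk,
      sub_eq_iff_eq_add.2]
    rw [mk_add_mk]
    simp only [smul_zero, add_zero, ← map_smul, ← map_add]
    congr 2
    simp [planeVector]⟩

/-- The quotient map onto the canonical algebra. -/
noncomputable def proj : PathAlgebra k (CanonicalVertex p) →ₐ[k] CanonicalAlgebra k p lam :=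
  RingQuot.mkAlgHom k (Rel k p lam)

theorem toStarExtension_proj (x : PathAlgebra k (CanonicalVertex p)) :
    toStarExtension hp lam (proj lam x) = toExtension (planeVector (lam 0)) hp x :=
  RingQuot.liftAlgHom_mkAlgHom_apply _ _ _ _

theorem proj_armPath : proj lam (armPath k p 2) =
    proj lam (armPath k p 0) - lam 0 • proj lam (armPath k p 1) := by
  rw [← map_smul, ← map_sub]
  exact RingQuot.mkAlgHom_rel k (Rel.mk (k := k) (p := p) (lam := lam) 0)

/-- The path algebra of the star in the canonical algebra. -/
noncomputable def starProj : PathAlgebra k (StarVertex p) →ₗ[k] CanonicalAlgebra k p lam :=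
  (proj lam).toLinearMap ∘ₗ (starData k p).liftLinear k

theorem starProj_apply (b : PathAlgebra k (StarVertex p)) :
    starProj lam b = proj lam ((starData k p).liftLinear k b) := rfl

theorem starProj_mul (a b : PathAlgebra k (StarVertex p)) :
    starProj lam (a * b) = starProj lam a * starProj lam b := by
  simp only [starProj_apply, LiftData.liftLinear_mul, map_mul]

/-- The module of the one-point extension in the canonical algebra. -/
noncomputable def moduleProj :
    StarRep k p (planeVector (lam 0)) →ₗ[k] CanonicalAlgebra k p lam :=
  homLinear p _ ((LinearMap.toSpanSingleton k _ (proj lam (armPath k p 0))).coprod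
    (LinearMap.toSpanSingleton k _ (proj lam (armPath k p 1))))
    fun i j => proj lam (armTail k p i j)

theorem moduleProj_apply (x : StarSpace k p (k × k)) : moduleProj lam (ofProd k p _ x) =
    x.1.1 • proj lam (armPath k p 0) + x.1.2 • proj lam (armPath k p 1) +
      ∑ a : Σ i, Fin (p i - 1), x.2 a • proj lam (armTail k p a.1 (a.2 + 1)) := rfl

-- The only condition that is not formal is the compatibility at the center for the third arm, which
-- is the defining relation of the canonical algebra.
include hp in
theorem moduleProj_smul (b : PathAlgebra k (StarVertex p))
    (m : StarRep k p (planeVector (lam 0))) :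
    moduleProj lam (op b • m) = moduleProj lam m * starProj lam b := by
  have hsrc (i : Fin 3) : armPath k p i * idem k source = armPath k p i :=
    armTail_mul_idem_src k p i 0 (by have := hp i; omega)
  refine homLinear_smul ((LinearMap.mul k (CanonicalAlgebra k p lam)).flip ∘ₗ starProj lam)
    ?_ _ _ ?_ ?_ ?_ ?_ b m
  · intro a b
    ext x
    simp [starProj_mul, mul_assoc]
  · intro i
    fin_cases i
    · simp [planeVector, armTail_zero]
    · simp [planeVector, armTail_zero]
    · change (1 : k) • proj lam (armPath k p 0) + (-lam 0) • proj lam (armPath k p 1) =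
        proj lam (armPath k p 2)
      rw [proj_armPath, one_smul, neg_smul, sub_eq_add_neg]
  · intro w
    change (w.1 • proj lam (armPath k p 0) + w.2 • proj lam (armPath k p 1)) *
      proj lam ((starData k p).liftLinear k (idem k .center)) =
        w.1 • proj lam (armPath k p 0) + w.2 • proj lam (armPath k p 1)
    rw [LiftData.liftLinear_idem]
    change _ * proj lam (idem k source) = _
    rw [add_mul, smul_mul_assoc, smul_mul_assoc, ← map_mul, ← map_mul, hsrc, hsrc]
  · intro i j
    change proj lam (armTail k p i (j + 1)) * proj lam ((starData k p).liftLinear k _) =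
      proj lam (armTail k p i (j + 1))
    rw [LiftData.liftLinear_idem, ← map_mul]
    exact congrArg _ (armTail_mul_idem_arm k p i j)
  · intro i j
    change proj lam (armTail k p i (j + 1)) * proj lam ((starData k p).liftLinear k _) =
      proj lam (armTail k p i j)
    rw [LiftData.liftLinear_ofArrow, ← map_mul]
    exact congrArg _ (armTail_eq k p i j (by omega)).symm

include hp in
theorem idem_sink_mul_moduleProj (m : StarRep k p (planeVector (lam 0))) :
    proj lam (idem k sink) * moduleProj lam m = moduleProj lam m := by
  obtain ⟨x, rfl⟩ := (ofProd k p _).surjective m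
  have h0 (i) : idem k sink * armPath k p i = armPath k p i :=
    idem_sink_mul_armTail k p i 0 (by have := hp i; omega)
  rw [moduleProj_apply, mul_add, mul_add, mul_smul_comm, mul_smul_comm, ← map_mul, ← map_mul, h0,
    h0, Finset.mul_sum]
  congr 1
  refine Finset.sum_congr rfl fun a _ => ?_
  rw [mul_smul_comm, ← map_mul, idem_sink_mul_armTail k p a.1 _ (by omega)]

/-- The homomorphism from the one-point extension to the canonical algebra. -/
noncomputable def ofStarExtension :
    OnePointExtension k (PathAlgebra k (StarVertex p)) (StarRep k p (planeVector (lam 0))) →ₐ[k]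
      CanonicalAlgebra k p lam :=
  OnePointExtension.lift (starProj lam) (moduleProj lam) (proj lam (idem k sink))
    (starProj_mul lam)
    (by rw [← map_mul, idem_mul_idem, if_pos rfl])
    (by rw [starProj_apply, ← map_add, starData_liftLinear_one, map_one])
    (idem_sink_mul_moduleProj hp lam)
    (fun m b => moduleProj_smul hp lam b m)

theorem ofStarExtension_mk (b : PathAlgebra k (StarVertex p))
    (m : StarRep k p (planeVector (lam 0))) (c : k) :
    ofStarExtension hp lam (mk _ _ _ b m c) =
      starProj lam b + (moduleProj lam m + c • proj lam (idem k sink)) := rfl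

theorem toStarExtension_comp_ofStarExtension :
    (toStarExtension hp lam).comp (ofStarExtension hp lam) = AlgHom.id k _ := by
  have hinr (m) : mk k (PathAlgebra k (StarVertex p)) (StarRep k p (planeVector (lam 0))) 0 m 0 =
    inr k _ _ m := rfl
  apply OnePointExtension.algHom_ext
  · intro a
    rw [AlgHom.comp_apply, ofStarExtension_mk]
    simp [starProj_apply, toStarExtension_proj, toExtension_starData]
  · intro m
    obtain ⟨⟨⟨a, b⟩, f⟩, rfl⟩ := (ofProd k p _).surjective m
    rw [AlgHom.comp_apply, ofStarExtension_mk, moduleProj_apply]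
    have h1 (y : Σ i, Fin (p i - 1)) :
        toExtension (planeVector (lam 0)) hp (armTail k p y.1 (y.2 + 1)) = _ :=
      toExtension_armTail _ hp y.1 (y.2 + 1) (by omega)
    simp only [map_zero, zero_add, zero_smul, add_zero, map_add, map_smul, map_sum,
      toStarExtension_proj, toExtension_armPath, h1, hinr, AlgHom.id_apply]
    simp only [← map_smul, ← map_sum, ← map_add]
    -- It remains to recover an element of the star module from its coordinates.
    congr 2
    simp only [gen_succ]
    refine Prod.ext ?_ ?_
    · simp [planeVector, Prod.fst_sum]
    · ext y
      simp [Prod.snd_sum, Finset.sum_apply, Pi.single_apply]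
  · rw [AlgHom.comp_apply, ofStarExtension_mk]
    simp only [map_zero, zero_add, one_smul, toStarExtension_proj, toExtension_idem]
    rfl

/-- Homomorphisms from the quotient are compared on the generators of the path algebra. Trivial
paths and inner arrows return at once; the last arrow of an arm passes through the module part. -/
theorem ofStarExtension_comp_toStarExtension :
    (ofStarExtension hp lam).comp (toStarExtension hp lam) = AlgHom.id k _ := by
  have h : ((ofStarExtension hp lam).comp (toStarExtension hp lam)).comp (proj lam) =
      proj lam := by
    apply PathAlgebra.algHom_ext
    · intro v
      rw [AlgHom.comp_apply, AlgHom.comp_apply, toStarExtension_proj, toExtension_idem]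
      obtain ⟨_ | v, rfl⟩ := optionEquiv.surjective v
      · refine (ofStarExtension_mk hp lam 0 0 1).trans ?_
        simp
        rfl
      · refine (congrArg _ (extensionData_e_ofStar _ hp v)).trans ?_
        rw [ofStarExtension_mk, starProj_apply, LiftData.liftLinear_idem]
        simp
        rfl
    · rintro a b ⟨⟨i, ⟨j, hj⟩⟩, rfl, rfl⟩
      change ofStarExtension hp lam (toStarExtension hp lam
        (proj lam (ofArrow k (arrow p i ⟨j, hj⟩)))) = proj lam (ofArrow k (arrow p i ⟨j, hj⟩))
      rw [toStarExtension_proj, toExtension_ofArrow]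
      by_cases h : j < p i - 1
      · rw [dif_pos h, ofStarExtension_mk, starProj_apply, LiftData.liftLinear_ofArrow]
        simp
        rfl
      · have h1 : p i - 1 = p i - 2 + 1 := by have := hp i; omega
        have h2 : p i - 2 + 1 + 1 = p i := by have := hp i; omega
        rw [dif_neg h, ofStarExtension_mk]
        obtain rfl : j = p i - 2 + 1 := by omega
        have h3 : gen (k := k) p (planeVector (lam 0)) i (p i - 1) =
            (0, Pi.single ⟨i, p i - 2, lt_of_two_le hp i⟩ 1) :=
          (congrArg _ h1).trans (gen_succ _ i ⟨p i - 2, lt_of_two_le hp i⟩)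
        rw [h3, moduleProj, homLinear_single]
        change _ + ((1 : k) • proj lam (armTail k p i (p i - 2 + 1)) + _) = _
        -- The tail that starts with the last arrow is that arrow alone.
        rw [armTail_eq k p i (p i - 2 + 1) hj, h2, armTail_length]
        simp
  exact RingQuot.ringQuot_ext' k _ _ h

/-- A canonical algebra with three weights as a one-point extension of the path algebra of a
star. -/
noncomputable def equivOnePointExtension : CanonicalAlgebra k p lam ≃ₐ[k]
    OnePointExtension k (PathAlgebra k (StarVertex p)) (StarRep k p (planeVector (lam 0))) :=
  AlgEquiv.ofAlgHom (toStarExtension hp lam) (ofStarExtension hp lam)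
    (toStarExtension_comp_ofStarExtension hp lam) (ofStarExtension_comp_toStarExtension hp lam)

end ThreeWeights

end CanonicalAlgebra

end CanonicalExtension

/-! ### Conclusion -/

theorem mainTheorem9 (k : Type u) [Field k] (p : Fin 3 → ℕ) (hp : ∀ i, 2 ≤ p i)
    (lam : Fin 1 → k) (hlam : ∀ j, lam j ≠ 0) :
    IsAccessible k (CanonicalAlgebra k p lam) ∧
    ∃ (M : Type u) (_ : AddCommGroup M) (_ : Module k M)
      (_ : Module (PathAlgebra k (StarVertex p))ᵐᵒᵖ M)
      (_ : IsScalarTower k (PathAlgebra k (StarVertex p))ᵐᵒᵖ M),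
      IsExceptionalModule k (PathAlgebra k (StarVertex p)) M ∧
      PathAlgebra.dimVector k M (StarVertex.center : StarVertex p) = 2 ∧
      (∀ (i : Fin 3) (j : Fin (p i - 1)), PathAlgebra.dimVector k M (StarVertex.arm i j) = 1) ∧
      Nonempty (CanonicalAlgebra k p lam ≃ₐ[k]
        OnePointExtension k (PathAlgebra k (StarVertex p)) M) := by
  have hM := StarRep.isExceptionalModule_planeVector (p := p) (hlam 0) hp
  have e := CanonicalAlgebra.equivOnePointExtension hp lam
  exact ⟨.extension (StarVertex.isAccessible k).1 _ hM e, _, _, _, _, _, hM,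
    by rw [StarRep.dimVector_center]; simp, StarRep.dimVector_arm, ⟨e⟩⟩
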